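/- Let $n\ge 1$. A cube is an axis-parallel cube $Q\subset\mathbb R^n$; $|Q|$ is its Lebesgue measure, and $tQ$ is the cube with the same centre and $t$ times the side length. For $0<\eta\le 1$, a family $\mathcal S$ of cubes is called $\eta$-sparse if there are pairwise disjoint measurable sets $E_Q\subset Q$ $(Q\in\mathcal S)$ with $|E_Q|\ge\eta|Q|$. Write $\langle f\rangle_{p,Q}=\big(\frac1{|Q|}\int_Q|f|^p\big)^{1/p}$, let $r'$ denote the conjugate exponent of $r$, and let $L^\infty_c$ be the space of real-valued bounded measurable functions on $\mathbb R^n$ with compact support (identified when equal a.e.). Let $K(x,y)$, $x\neq y$, be a real-valued measurable kernel on $\mathbb R^n\times\mathbb R^n$ off the diagonal, and put $K^*(x,y)=K(y,x)$. For $1\le r\le\infty$ we write $K\in H_r$ if $$\sup_Q\ \sup_{x,x'\in\frac12Q}\ \sum_{k=1}^\infty|2^kQ|^{1/r'}\,\|K(x,\cdot)-K(x',\cdot)\|_{L^r(2^kQ\setminus 2^{k-1}Q)}<\infty .$$ Let $T$ be a linear operator from $L^\infty_c$ to $L^1_{\rm loc}(\mathbb R^n)$ such that, for every $f\in L^\infty_c$,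 $$Tf(x)=\int_{\mathbb R^n}K(x,y)f(y)\,dy\qquad\text{for a.e. }x\notin\operatorname{supp}f,$$ the integral being absolutely convergent, and let $T^*$ be its transpose: $T^*g\in L^1_{\rm loc}(\mathbb R^n)$ and $\int (Tf)\,g=\int f\,T^*g$ for all $f,g\in L^\infty_c$. Theorem. Assume that $K\in H_r$ for some $1<r\le\infty$ and that $K^*\in H_1$. Suppose that there is a constant $C>0$ such that for every cube $Q$ and every measurable $E\subset Q$, $$\int_Q|T^*\chi_E|\,dx\le C|Q|.$$ Then there is a constant $C'<\infty$, independent of $f$, such that for every $f\in L^\infty_c$ there exists a $\frac1{2\cdot3^n}$-sparse family $\mathcal S$ of cubes with $$|Tf(x)|\le C'\sum_{Q\in\mathcal S}\langle f\rangle_{r',Q}\,\chi_Q(x)\qquad\text{for a.e. }x\in\mathbb R^n .$$ -/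

import Mathlib

open MeasureTheory Set
open scoped ENNReal NNReal

namespace SparseT1

/-- A cube in `ℝⁿ` with sides parallel to the axes, given by its centre and its side length. -/
structure Cube (n : ℕ) where
  center : Fin n → ℝ
  side : ℝ
  side_pos : 0 < side

/-- The (closed) set of points of a cube. -/
def Cube.toSet {n : ℕ} (Q : Cube n) : Set (Fin n → ℝ) :=
  {x | ∀ i, |x i - Q.center i| ≤ Q.side / 2}

/-- The cube `t Q` with the same centre as `Q` and side length `t` times as large. -/
def Cube.dilate {n : ℕ} (Q : Cube n) (t : ℝ) (ht : 0 < t) : Cube n :=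
  ⟨Q.center, t * Q.side, mul_pos ht Q.side_pos⟩

/-- The cube `2 ^ k Q`. -/
def Cube.twoPow {n : ℕ} (Q : Cube n) (k : ℕ) : Cube n :=
  Q.dilate (2 ^ k) (by positivity)

/-- The cube `(1/2) Q`. -/
noncomputable def Cube.half {n : ℕ} (Q : Cube n) : Cube n :=
  Q.dilate (1 / 2) (by norm_num)

/-- A family `S` of cubes is `η`-sparse if there are pairwise disjoint measurable sets
`E Q ⊆ Q`, `Q ∈ S`, with `|E Q| ≥ η |Q|`. -/
def IsSparse {n : ℕ} (η : ℝ≥0∞) (S : Set (Cube n)) : Prop :=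
  ∃ E : Cube n → Set (Fin n → ℝ),
    (∀ Q ∈ S, MeasurableSet (E Q) ∧ E Q ⊆ Q.toSet ∧ η * volume Q.toSet ≤ volume (E Q)) ∧
      S.PairwiseDisjoint E

/-- The average `⟨f⟩_{p,Q} = (|Q|⁻¹ ∫_Q |f|^p)^{1/p}`, for `0 < p < ∞`. -/
noncomputable def cubeAvg {n : ℕ} (p : ℝ) (f : (Fin n → ℝ) → ℝ) (Q : Cube n) : ℝ≥0∞ :=
  ((volume Q.toSet)⁻¹ * ∫⁻ x in Q.toSet, ‖f x‖ₑ ^ p) ^ (1 / p)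

/-- The function `∑_{Q ∈ S} ⟨f⟩_{p,Q} χ_Q`, with values in `[0, ∞]`. -/
noncomputable def sparseSum {n : ℕ} (p : ℝ) (S : Set (Cube n)) (f : (Fin n → ℝ) → ℝ)
    (x : Fin n → ℝ) : ℝ≥0∞ :=
  ∑' Q : S, Q.1.toSet.indicator (fun _ => cubeAvg p f Q.1) x

/-- The `L^r`-Hörmander condition on a kernel `K`, `1 ≤ r ≤ ∞`; here `r.conjExponent` is the
conjugate exponent `r'`, which is `∞` for `r = 1` and `1` for `r = ∞`. Only the values of `K` off
the diagonal enter. -/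
def Hormander {n : ℕ} (r : ℝ≥0∞) (K : (Fin n → ℝ) → (Fin n → ℝ) → ℝ) : Prop :=
  (⨆ (Q : Cube n) (x ∈ Q.half.toSet) (x' ∈ Q.half.toSet),
    ∑' k : ℕ, volume (Q.twoPow (k + 1)).toSet ^ (r.conjExponent)⁻¹.toReal *
      eLpNorm (fun y => K x y - K x' y) r
        (volume.restrict ((Q.twoPow (k + 1)).toSet \ (Q.twoPow k).toSet))) < ∞

/-- `f` belongs to the space of bounded functions with compact support. -/
def MemLinftyC {n : ℕ} (f : (Fin n → ℝ) → ℝ) : Prop :=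
  MemLp f ∞ volume ∧ HasCompactSupport f

/-- `T` is a linear operator that is well defined on bounded functions with compact support, with
locally integrable values (functions being identified when equal a.e.), and `T` is represented by
the kernel `K` off the support of the function. What `T` does to other functions is irrelevant. -/
structure IsIntegralOperator {n : ℕ} (T : ((Fin n → ℝ) → ℝ) → ((Fin n → ℝ) → ℝ))
    (K : (Fin n → ℝ) → (Fin n → ℝ) → ℝ) : Prop where
  locallyIntegrable : ∀ f, MemLinftyC f → LocallyIntegrable (T f) volume
  congr_ae : ∀ f g, MemLinftyC f → MemLinftyC g → f =ᵐ[volume] g → T f =ᵐ[volume] T g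
  map_add : ∀ f g, MemLinftyC f → MemLinftyC g → T (f + g) =ᵐ[volume] T f + T g
  map_smul : ∀ (c : ℝ) (f), MemLinftyC f → T (c • f) =ᵐ[volume] c • T f
  repr : ∀ f, MemLinftyC f → ∀ᵐ x, x ∉ tsupport f →
    Integrable (fun y => K x y * f y) volume ∧ T f x = ∫ y, K x y * f y

/-- `T'` is the transpose of `T` on bounded functions with compact support:
`∫ (T f) g = ∫ f (T' g)`. -/
structure IsTranspose {n : ℕ} (T T' : ((Fin n → ℝ) → ℝ) → ((Fin n → ℝ) → ℝ)) : Prop where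
  locallyIntegrable : ∀ g, MemLinftyC g → LocallyIntegrable (T' g) volume
  duality : ∀ f g, MemLinftyC f → MemLinftyC g → ∫ x, T f x * g x = ∫ x, f x * T' g x

end SparseT1

/-! Write p = r' and F_q = f χ_{3q} for a cell q of a triadic grid. Everything rests on a recursive
inequality (`exists_isChildren`): every cell q has disjoint subcells, its children, of total measure
at most |q|/2, such that |T F_q| ≤ C⟨f⟩_{p,3q} a.e. on q off the children, and |T F_q| ≤ C⟨f⟩_{p,3q}
+ |T F_{q'}| a.e. on each child q'. The m-th generation below q has measure at most 2^{-m}|q|, so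
almost every point leaves the tree after finitely many steps; there the recursion is a finite sum
and no limit is taken. The sets "q minus its children" are disjoint and fill half of q, and |3q| =
3^n|q|, which gives the sparseness constant 1/(2·3^n) for the cubes 3q.

The local estimate. By duality the testing condition bounds T from L^∞ to L^1 on a cube
(`lintegral_le_of_bounded`). The H_1 condition on the transposed kernel controls T on the mean-zero
part of a Calderón–Zygmund decomposition, away from the tripled cells (`lintegral_le_of_mean_zero`).
At a single height comparable to ⟨f⟩_{p,3q} the two give a set Ω(q) with |Ω(q)| ≤ |q|/(4·3^n) such
that, on q off Ω(q), both T F_q and the L^p maximal function of F_q are bounded by a multiple of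
⟨f⟩_{p,3q} (`exists_hasExceptionalSets`).

The recursion. The children are the maximal subcells in which Ω(q) has density above 1/(2·3^n); by
maximality the density in a child is at most 1/2, so a child q' contains a point x' outside both
Ω(q) and Ω(q'). At x' both T F_q and T F_{q'} are controlled, hence so is T(F_q - F_{q'}). Since F_q
- F_{q'} vanishes on 3q', the condition H_r and the maximal bound at x' control the oscillation of
T(F_q - F_{q'}) over q' (`lintegral_kernel_sub_mul_le`). One good point thus does the work usually
given to a maximal truncated operator.

The grid is centred at the origin, so its central cells exhaust the space. If f lives in a central
cell, the space splits into cells whose triples all contain the support (`topCells`); there F_q = f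
and the recursion can start. -/

namespace SparseT1

variable {n : ℕ}

/-! ### Cubes -/

theorem Cube.toSet_eq_closedBall (Q : Cube n) :
    Q.toSet = Metric.closedBall Q.center (Q.side / 2) := by
  ext x
  simp only [Cube.toSet, mem_ofPred_eq, Metric.mem_closedBall, Real.dist_eq,
    dist_pi_le_iff (half_pos Q.side_pos).le]

theorem Cube.measurableSet_toSet (Q : Cube n) : MeasurableSet Q.toSet := by
  rw [Q.toSet_eq_closedBall]; exact Metric.isClosed_closedBall.measurableSet

theorem Cube.isClosed_toSet (Q : Cube n) : IsClosed Q.toSet := by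
  rw [Q.toSet_eq_closedBall]; exact Metric.isClosed_closedBall

theorem Cube.isCompact_toSet (Q : Cube n) : IsCompact Q.toSet := by
  rw [Q.toSet_eq_closedBall]; exact isCompact_closedBall _ _

theorem Cube.volume_toSet (Q : Cube n) : volume Q.toSet = ENNReal.ofReal Q.side ^ n := by
  rw [Q.toSet_eq_closedBall, Real.volume_pi_closedBall _ (half_pos Q.side_pos).le,
    mul_div_cancel₀ _ (two_ne_zero), Fintype.card_fin, ENNReal.ofReal_pow Q.side_pos.le]

theorem Cube.volume_toSet_ne_top (Q : Cube n) : volume Q.toSet ≠ ∞ := by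
  rw [Q.volume_toSet]; exact ENNReal.pow_ne_top ENNReal.ofReal_ne_top

theorem Cube.volume_toSet_ne_zero (Q : Cube n) : volume Q.toSet ≠ 0 := by
  rw [Q.volume_toSet]
  exact pow_ne_zero _ (by simpa using Q.side_pos)

theorem Cube.volume_dilate (Q : Cube n) (t : ℝ) (ht : 0 < t) :
    volume (Q.dilate t ht).toSet = ENNReal.ofReal t ^ n * volume Q.toSet := by
  rw [Cube.volume_toSet, Cube.volume_toSet, ← mul_pow, ← ENNReal.ofReal_mul ht.le]; rfl

/-! ### The centred triadic grid -/

/-- The index of the triadic cell of generation `k` that contains `x`. -/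
noncomputable def idx (k : ℤ) (x : Fin n → ℝ) : Fin n → ℤ := fun i => ⌊x i / 3 ^ k + 1 / 2⌋

/-- The labels of the cells of the triadic grid: `(k, v)` stands for the half-open cube of side
`3 ^ k` and centre `3 ^ k v`. -/
abbrev Triadic (n : ℕ) := ℤ × (Fin n → ℤ)

/-- The cell with a given label. -/
def cell (q : Triadic n) : Set (Fin n → ℝ) := {x | idx q.1 x = q.2}

/-- The closure of a cell, as a cube. -/
noncomputable def closedCell (q : Triadic n) : Cube n :=
  ⟨fun i => 3 ^ q.1 * q.2 i, 3 ^ q.1, by positivity⟩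

/-- The closed cube with the same centre as a cell and three times its side. -/
noncomputable def triple (q : Triadic n) : Cube n := (closedCell q).dilate 3 (by norm_num)

/-- The parent of a cell. -/
def parent (q : Triadic n) : Triadic n := (q.1 + 1, fun i => (q.2 i + 1) / 3)

theorem mem_cell_iff {q : Triadic n} {x : Fin n → ℝ} :
    x ∈ cell q ↔ ∀ i, 3 ^ q.1 * (q.2 i - 1 / 2 : ℝ) ≤ x i ∧
      x i < 3 ^ q.1 * (q.2 i + 1 / 2 : ℝ) := by
  have h3 : (0 : ℝ) < 3 ^ q.1 := by positivity
  simp only [cell, idx, mem_ofPred_eq, funext_iff, Int.floor_eq_iff]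
  refine forall_congr' fun i => and_congr ?_ ?_
  · rw [← sub_le_iff_le_add, le_div_iff₀' h3]
  · rw [← lt_sub_iff_add_lt, div_lt_iff₀' h3]
    ring_nf

theorem mem_cell_idx (k : ℤ) (x : Fin n → ℝ) : x ∈ cell (k, idx k x) := rfl

theorem cell_eq_pi (q : Triadic n) :
    cell q = univ.pi fun i =>
      Ico (3 ^ q.1 * (q.2 i - 1 / 2 : ℝ)) (3 ^ q.1 * (q.2 i + 1 / 2 : ℝ)) := by
  ext x; simp [mem_cell_iff]

theorem measurableSet_cell (q : Triadic n) : MeasurableSet (cell q) := by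
  rw [cell_eq_pi]; exact MeasurableSet.univ_pi fun i => measurableSet_Ico

theorem volume_cell (q : Triadic n) : volume (cell q) = ENNReal.ofReal (3 ^ q.1) ^ n := by
  rw [cell_eq_pi, Real.volume_pi_Ico]
  have : ∀ i, ENNReal.ofReal (3 ^ q.1 * (q.2 i + 1 / 2 : ℝ) - 3 ^ q.1 * (q.2 i - 1 / 2 : ℝ))
      = ENNReal.ofReal (3 ^ q.1) := fun i => by congr 1; ring
  rw [Finset.prod_congr rfl fun i _ => this i]; simp

theorem volume_cell_ne_top (q : Triadic n) : volume (cell q) ≠ ∞ := by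
  rw [volume_cell]; exact ENNReal.pow_ne_top ENNReal.ofReal_ne_top

theorem volume_cell_ne_zero (q : Triadic n) : volume (cell q) ≠ 0 := by
  rw [volume_cell]
  exact pow_ne_zero _ (by rw [ENNReal.ofReal_ne_zero_iff]; positivity)

theorem volume_closedCell (q : Triadic n) : volume (closedCell q).toSet = volume (cell q) := by
  rw [volume_cell, Cube.volume_toSet]; rfl

theorem volume_triple (q : Triadic n) : volume (triple q).toSet = 3 ^ n * volume (cell q) := by
  rw [triple, Cube.volume_dilate, volume_closedCell, ENNReal.ofReal_ofNat]

theorem volume_parent (q : Triadic n) : volume (cell (parent q)) = 3 ^ n * volume (cell q) := by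
  rw [volume_cell, volume_cell, ← mul_pow, parent, zpow_add_one₀ (by norm_num), mul_comm,
    ENNReal.ofReal_mul (by norm_num), ENNReal.ofReal_ofNat]

/-- This is ⌊(t + 1)/3⌋ = ⌊(⌊t⌋ + 1)/3⌋ with t = x i / 3 ^ k + 1/2. The ratio 3 is odd, so the shift
by 1/2 that centres the cells is reproduced in the next generation and the grid is nested. -/
theorem idx_succ (k : ℤ) (x : Fin n → ℝ) : idx (k + 1) x = fun i => (idx k x i + 1) / 3 := by
  funext i
  have := Int.floor_div_natCast (x i / 3 ^ k + 1 / 2 + 1) 3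
  rw [Int.floor_add_one] at this
  simp only [idx]
  push_cast at this
  rw [← this]
  congr 1
  rw [zpow_add_one₀ (by norm_num)]
  field_simp
  ring

theorem idx_eq_of_le {j k : ℤ} (hjk : j ≤ k) {x y : Fin n → ℝ} (h : idx j x = idx j y) :
    idx k x = idx k y := by
  induction k, hjk using Int.leInduction with
  | base => exact h
  | succ k _ ih => rw [idx_succ, idx_succ, ih]

theorem cell_subset_cell {p q : Triadic n} (hpq : p.1 ≤ q.1) {x : Fin n → ℝ} (hp : x ∈ cell p)
    (hq : x ∈ cell q) : cell p ⊆ cell q := by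
  intro y hy
  have h : idx p.1 y = idx p.1 x := Eq.trans hy (Eq.symm hp)
  exact (idx_eq_of_le hpq h).trans hq

theorem cell_subset_parent (q : Triadic n) : cell q ⊆ cell (parent q) := by
  intro x hx
  change idx (q.1 + 1) x = _
  rw [idx_succ, show idx q.1 x = q.2 from hx]; rfl

theorem eq_of_mem_cell {p q : Triadic n} (hpq : p.1 = q.1) {x : Fin n → ℝ} (hp : x ∈ cell p)
    (hq : x ∈ cell q) : p = q := by
  obtain ⟨k, v⟩ := p
  obtain ⟨l, w⟩ := q
  obtain rfl : k = l := hpq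
  obtain rfl : v = w := Eq.trans (Eq.symm hp) hq
  rfl

theorem center_mem_cell (q : Triadic n) : (closedCell q).center ∈ cell q := by
  have h3 : (0 : ℝ) < 3 ^ q.1 := by positivity
  rw [mem_cell_iff]
  intro i
  constructor <;> simp only [closedCell] <;> nlinarith

theorem cell_subset_closedCell (q : Triadic n) : cell q ⊆ (closedCell q).toSet := by
  intro x hx i
  have := mem_cell_iff.1 hx i
  simp only [closedCell]
  rw [abs_le]
  constructor <;> linarith

theorem cell_subset_triple (q : Triadic n) : cell q ⊆ (triple q).toSet := by
  intro x hx i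
  have := cell_subset_closedCell q hx i
  have h3 : (0 : ℝ) < 3 ^ q.1 := by positivity
  simp only [closedCell, triple, Cube.dilate] at *
  linarith

/-- In the strict case the side of `triple p` is at most that of `cell q`, and its centre lies in
`cell q`. -/
theorem triple_subset_triple {p q : Triadic n} (h : cell p ⊆ cell q) (hpq : p.1 ≤ q.1) :
    (triple p).toSet ⊆ (triple q).toSet := by
  rcases hpq.eq_or_lt with heq | hlt
  · rw [eq_of_mem_cell heq (center_mem_cell p) (h (center_mem_cell p))]
  · intro x hx i
    have h1 := hx i
    have h2 := cell_subset_closedCell q (h (center_mem_cell p)) i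
    have h3 : (3 : ℝ) ^ (p.1 + 1) ≤ 3 ^ q.1 := zpow_le_zpow_right₀ (by norm_num) hlt
    rw [zpow_add_one₀ (by norm_num)] at h3
    have h4 : (0 : ℝ) < 3 ^ p.1 := by positivity
    simp only [closedCell, triple, Cube.dilate] at *
    rw [abs_le] at *
    constructor <;> linarith

/-- A point whose index differs by at most one in each coordinate lies in the tripled cell. -/
theorem mem_triple_of_idx {q : Triadic n} {x : Fin n → ℝ}
    (h : ∀ i, |idx q.1 x i - q.2 i| ≤ 1) : x ∈ (triple q).toSet := by
  intro i
  have h1 : |(idx q.1 x i - q.2 i : ℝ)| ≤ 1 := by exact_mod_cast h i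
  have h2 := mem_cell_iff.1 (mem_cell_idx q.1 x) i
  have h3 : (0 : ℝ) < 3 ^ q.1 := by positivity
  simp only [closedCell, triple, Cube.dilate] at *
  rw [abs_le] at *
  constructor <;> nlinarith

theorem idx_sub_le_one {k : ℤ} {x y : Fin n → ℝ} (h : ∀ i, |x i - y i| ≤ 3 ^ k) (i : Fin n) :
    |idx k x i - idx k y i| ≤ 1 := by
  have h3 : (0 : ℝ) < 3 ^ k := by positivity
  have h1 : |x i / 3 ^ k - y i / 3 ^ k| ≤ 1 := by
    rw [← sub_div, abs_div, abs_of_pos h3, div_le_one h3]; exact h i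
  rw [abs_le] at *
  simp only [idx]
  constructor
  · have : ⌊y i / 3 ^ k + 1 / 2 ⌋ ≤ ⌊x i / 3 ^ k + 1 / 2 + 1⌋ := Int.floor_le_floor (by linarith)
    rw [Int.floor_add_one] at this
    linarith
  · have : ⌊x i / 3 ^ k + 1 / 2 ⌋ ≤ ⌊y i / 3 ^ k + 1 / 2 + 1⌋ := Int.floor_le_floor (by linarith)
    rw [Int.floor_add_one] at this
    linarith

/-- The integral over a cube of side at most `3 ^ k` is controlled by cells of generation `k`
whose triples contain a given point of the cube. -/
theorem lintegral_cube_le {R : Cube n} {k : ℤ} (hR : R.side ≤ 3 ^ k) {x : Fin n → ℝ}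
    (hx : x ∈ R.toSet) (F : (Fin n → ℝ) → ℝ≥0∞) {c : ℝ≥0∞}
    (hc : ∀ q : Triadic n, q.1 = k → x ∈ (triple q).toSet → ∫⁻ y in cell q, F y ≤ c) :
    ∫⁻ y in R.toSet, F y ≤ 3 ^ n * c := by
  set s : Finset (Fin n → ℤ) := Fintype.piFinset fun i => Finset.Icc (idx k x i - 1) (idx k x i + 1)
  have hcard : s.card = 3 ^ n := by
    simp only [s, Fintype.card_piFinset, Int.card_Icc]
    have : ∀ i, (idx k x i + 1 + 1 - (idx k x i - 1)).toNat = 3 := fun i => by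
      rw [show idx k x i + 1 + 1 - (idx k x i - 1) = 3 by ring]; rfl
    simp [this]
  have hsub : R.toSet ⊆ ⋃ v ∈ s, cell (k, v) := by
    intro y hy
    have hxy : ∀ i, |y i - x i| ≤ 3 ^ k := fun i => by
      have h1 := hx i
      have h2 := hy i
      rw [abs_le] at *
      constructor <;> linarith
    refine mem_iUnion₂.2 ⟨idx k y, ?_, mem_cell_idx k y⟩
    refine Fintype.mem_piFinset.2 fun i => Finset.mem_Icc.2 ?_
    have := abs_le.1 (idx_sub_le_one hxy i)
    constructor <;> linarith
  calc ∫⁻ y in R.toSet, F y ≤ ∫⁻ y in ⋃ v ∈ s, cell (k, v), F y := lintegral_mono_set hsub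
    _ ≤ ∑ v ∈ s, ∫⁻ y in cell (k, v), F y := by
        refine (lintegral_biUnion_finset ?_ (fun v _ => measurableSet_cell _) F).le
        intro v _ w _ hvw
        exact Set.disjoint_left.2 fun y hv hw => hvw (Eq.trans (Eq.symm hv) hw)
    _ ≤ ∑ v ∈ s, c := by
        refine Finset.sum_le_sum fun v hv => hc _ rfl (mem_triple_of_idx fun i => ?_)
        have := Finset.mem_Icc.1 (Fintype.mem_piFinset.1 hv i)
        rw [abs_le]
        constructor <;> simp only [] <;> linarith
    _ = 3 ^ n * c := by rw [Finset.sum_const, hcard, nsmul_eq_mul]; push_cast; rfl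

/-! ### Maximal cells -/

/-- The maximal cells of a family of cells. -/
def maximalCells (P : Set (Triadic n)) : Set (Triadic n) :=
  {q ∈ P | ∀ p ∈ P, cell q ⊆ cell p → p.1 ≤ q.1}

theorem maximalCells_subset (P : Set (Triadic n)) : maximalCells P ⊆ P := fun _ h => h.1

theorem exists_mem_maximalCells {P : Set (Triadic n)} {k : ℤ} (hk : ∀ q ∈ P, q.1 ≤ k)
    {p : Triadic n} (hp : p ∈ P) : ∃ q ∈ maximalCells P, cell p ⊆ cell q ∧ p.1 ≤ q.1 := by
  obtain ⟨l, ⟨q, hqP, hpq, rfl⟩, hmax⟩ := Int.exists_greatest_of_bdd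
    (P := fun l => ∃ q ∈ P, cell p ⊆ cell q ∧ q.1 = l)
    ⟨k, by rintro z ⟨q, hq, -, rfl⟩; exact hk q hq⟩ ⟨p.1, p, hp, Subset.rfl, rfl⟩
  exact ⟨q, ⟨hqP, fun r hr hqr => hmax _ ⟨r, hr, hpq.trans hqr, rfl⟩⟩, hpq,
    hmax _ ⟨p, hp, Subset.rfl, rfl⟩⟩

theorem pairwiseDisjoint_maximalCells (P : Set (Triadic n)) :
    (maximalCells P).PairwiseDisjoint cell := by
  intro p hp q hq hne
  rw [Function.onFun, Set.disjoint_left]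
  intro x hxp hxq
  refine hne ?_
  rcases le_total p.1 q.1 with h | h
  · exact eq_of_mem_cell (le_antisymm h (hp.2 q hq.1 (cell_subset_cell h hxp hxq))) hxp hxq
  · exact eq_of_mem_cell (le_antisymm (hq.2 p hp.1 (cell_subset_cell h hxq hxp)) h) hxp hxq

/-- The source of all upper bounds on selected cells: the parent fails the selection criterion, and
passing to it costs a factor 3 ^ n in volume. -/
theorem parent_notMem_of_mem_maximalCells {P : Set (Triadic n)} {q : Triadic n}
    (hq : q ∈ maximalCells P) : parent q ∉ P := fun h => by
  have := hq.2 _ h (cell_subset_parent q)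
  simp only [parent] at this
  lia

/-! ### Lebesgue differentiation along the grid -/

theorem cell_ae_eq_closedCell (q : Triadic n) : cell q =ᵐ[volume] (closedCell q).toSet :=
  ae_eq_of_subset_of_measure_ge (cell_subset_closedCell q) (volume_closedCell q).le
    (measurableSet_cell q).nullMeasurableSet (closedCell q).volume_toSet_ne_top

theorem tendsto_zpow_neg_nhdsGT (k : ℤ) :
    Filter.Tendsto (fun m : ℕ => (3 : ℝ) ^ (k - m) / 2) Filter.atTop (nhdsWithin 0 (Ioi 0)) := by
  refine tendsto_nhdsWithin_iff.2 ⟨?_, Filter.Eventually.of_forall fun m => by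
    simp only [mem_Ioi]; positivity⟩
  have h : ∀ m : ℕ, (3 : ℝ) ^ (k - m) / 2 = 3 ^ k / 2 * (1 / 3) ^ m := fun m => by
    rw [zpow_sub₀ (by norm_num), zpow_natCast, one_div, inv_pow]; ring
  simp_rw [h]
  rw [show (0 : ℝ) = 3 ^ k / 2 * 0 by simp]
  exact (tendsto_pow_atTop_nhds_zero_of_lt_one (by norm_num) (by norm_num)).const_mul _

/-- If a locally integrable function has averages at most `c` over all small cells that contain a
point, then its value at almost every such point is at most `c`. -/
theorem ae_le_of_average_le {h : (Fin n → ℝ) → ℝ} (hh : LocallyIntegrable h volume) (k : ℤ) (c : ℝ) :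
    ∀ᵐ x, (∀ q : Triadic n, q.1 ≤ k → x ∈ cell q → ⨍ y in cell q, h y ≤ c) → h x ≤ c := by
  -- Balls of the sup norm are cubes. The balls need not be centred at x; the parameter 1 asks only
  -- that x lie in each of them.
  filter_upwards [IsUnifLocDoublingMeasure.ae_tendsto_average volume hh 1] with x hx hq
  have := hx (l := Filter.atTop) (fun m : ℕ => (closedCell (k - m, idx (k - m) x)).center)
    (fun m : ℕ => (3 : ℝ) ^ (k - m) / 2) (tendsto_zpow_neg_nhdsGT k)
    (Filter.Eventually.of_forall fun m => by
      have := cell_subset_closedCell _ (mem_cell_idx (k - m) x)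
      rw [Cube.toSet_eq_closedBall] at this
      rwa [one_mul])
  refine le_of_tendsto this (Filter.Eventually.of_forall fun m => ?_)
  have h2 := hq (k - m, idx (k - m) x) (by simp) (mem_cell_idx _ x)
  have h3 := setAverage_congr (μ := volume) (f := h) (cell_ae_eq_closedCell (k - m, idx (k - m) x))
  rw [Cube.toSet_eq_closedBall] at h3
  exact h3 ▸ h2

/-- Almost every point of a set lies in arbitrarily small cells in which the set has density larger
than a given `θ < 1`. -/
theorem ae_exists_density (S : Set (Fin n → ℝ)) (hS : MeasurableSet S) (k : ℤ) {θ : ℝ≥0∞}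
    (hθ : θ < 1) :
    ∀ᵐ x, x ∈ S → ∃ q : Triadic n, q.1 ≤ k ∧ x ∈ cell q ∧
      θ * volume (cell q) < volume (cell q ∩ S) := by
  rw [← ae_restrict_iff' hS]
  filter_upwards [IsUnifLocDoublingMeasure.ae_tendsto_measure_inter_div volume S 1] with x hx
  have := hx (l := Filter.atTop) (fun m : ℕ => (closedCell (k - m, idx (k - m) x)).center)
    (fun m : ℕ => (3 : ℝ) ^ (k - m) / 2) (tendsto_zpow_neg_nhdsGT k)
    (Filter.Eventually.of_forall fun m => by
      have := cell_subset_closedCell _ (mem_cell_idx (k - m) x)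
      rw [Cube.toSet_eq_closedBall] at this
      rwa [one_mul])
  obtain ⟨m, hm⟩ := (this.eventually (lt_mem_nhds hθ)).exists
  refine ⟨(k - m, idx (k - m) x), by simp, mem_cell_idx _ x, ?_⟩
  have h3 := cell_ae_eq_closedCell (k - m, idx (k - m) x)
  have h4 : volume (S ∩ (closedCell (k - m, idx (k - m) x)).toSet)
      = volume (cell (k - m, idx (k - m) x) ∩ S) := by
    rw [inter_comm]; exact measure_congr (h3.symm.inter (Filter.EventuallyEq.refl _ _))
  have hm' : θ < volume (S ∩ (closedCell (k - m, idx (k - m) x)).toSet) /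
      volume (closedCell (k - m, idx (k - m) x)).toSet := by
    rw [Cube.toSet_eq_closedBall]; exact hm
  rw [h4, volume_closedCell] at hm'
  exact (ENNReal.lt_div_iff_mul_lt (Or.inl (volume_cell_ne_zero _))
    (Or.inl (volume_cell_ne_top _))).1 hm'

/-! ### Consequences of the Hörmander conditions -/

/-- The `L^r`-Hörmander condition with an explicit constant. -/
def HormanderBound (r : ℝ≥0∞) (K : (Fin n → ℝ) → (Fin n → ℝ) → ℝ) (H : ℝ≥0) : Prop :=
  ∀ (Q : Cube n), ∀ x ∈ Q.half.toSet, ∀ x' ∈ Q.half.toSet,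
    ∑' k : ℕ, volume (Q.twoPow (k + 1)).toSet ^ (r.conjExponent)⁻¹.toReal *
      eLpNorm (fun y => K x y - K x' y) r
        (volume.restrict ((Q.twoPow (k + 1)).toSet \ (Q.twoPow k).toSet)) ≤ H

/-- The testing condition: `T' χ_E` has average at most `C` on every cube that contains `E`. -/
def TestingBound (T' : ((Fin n → ℝ) → ℝ) → ((Fin n → ℝ) → ℝ)) (C : ℝ≥0) : Prop :=
  ∀ (Q : Cube n) (E : Set (Fin n → ℝ)), MeasurableSet E → E ⊆ Q.toSet →
    ∫⁻ x in Q.toSet, ‖T' (E.indicator fun _ => (1 : ℝ)) x‖ₑ ≤ C * volume Q.toSet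

theorem Hormander.exists_bound {r : ℝ≥0∞} {K : (Fin n → ℝ) → (Fin n → ℝ) → ℝ}
    (h : Hormander r K) : ∃ H : ℝ≥0, HormanderBound r K H := by
  obtain ⟨H, hH⟩ := WithTop.ne_top_iff_exists.1 (ne_of_lt h)
  refine ⟨H, fun Q x hx x' hx' => ?_⟩
  refine le_of_le_of_eq ?_ hH.symm
  exact le_iSup₂_of_le Q x (le_iSup₂_of_le hx x' (le_iSup_of_le hx' le_rfl))

theorem Cube.mem_twoPow_iff {Q : Cube n} {k : ℕ} {x : Fin n → ℝ} :
    x ∈ (Q.twoPow k).toSet ↔ ‖x - Q.center‖ ≤ 2 ^ k * Q.side / 2 := by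
  rw [Cube.toSet_eq_closedBall, mem_closedBall_iff_norm]; rfl

theorem Cube.compl_subset_iUnion_annuli (Q : Cube n) :
    Q.toSetᶜ ⊆ ⋃ k : ℕ, (Q.twoPow (k + 1)).toSet \ (Q.twoPow k).toSet := by
  intro x hx
  have hex : ∃ k : ℕ, x ∈ (Q.twoPow k).toSet := by
    obtain ⟨k, hk⟩ := pow_unbounded_of_one_lt (‖x - Q.center‖ / (Q.side / 2)) one_lt_two
    refine ⟨k, Cube.mem_twoPow_iff.2 ?_⟩
    rw [div_lt_iff₀ (half_pos Q.side_pos)] at hk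
    linarith
  classical
  have h0 : Nat.find hex ≠ 0 := fun h => by
    have := Nat.find_spec hex
    rw [h, Cube.mem_twoPow_iff] at this
    refine hx ?_
    rw [Cube.toSet_eq_closedBall, mem_closedBall_iff_norm]
    simpa using this
  obtain ⟨m, hm⟩ := Nat.exists_eq_succ_of_ne_zero h0
  refine mem_iUnion.2 ⟨m, ?_, Nat.find_min hex (by lia)⟩
  have := Nat.find_spec hex
  rwa [hm] at this

theorem lintegral_compl_cube_le (Q : Cube n) (F : (Fin n → ℝ) → ℝ≥0∞) :
    ∫⁻ y in Q.toSetᶜ, F y ≤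
      ∑' k : ℕ, ∫⁻ y in (Q.twoPow (k + 1)).toSet \ (Q.twoPow k).toSet, F y :=
  (lintegral_mono_set Q.compl_subset_iUnion_annuli).trans (lintegral_iUnion_le _ _)

theorem mem_half_dilate_two {q : Triadic n} {x : Fin n → ℝ} (hx : x ∈ (closedCell q).toSet) :
    x ∈ ((closedCell q).dilate 2 two_pos).half.toSet := by
  intro i
  have := hx i
  simp only [Cube.half, Cube.dilate]
  linarith

theorem dilate_two_subset_triple (q : Triadic n) :
    ((closedCell q).dilate 2 two_pos).toSet ⊆ (triple q).toSet := by
  intro x hx i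
  have := hx i
  have h3 := (closedCell q).side_pos
  simp only [triple, Cube.dilate] at *
  linarith

theorem one_le_conjExponent (r : ℝ≥0∞) : 1 ≤ r.conjExponent := by
  simp [ENNReal.conjExponent]

theorem conjExponent_ne_top {r : ℝ≥0∞} (hr : 1 < r) : r.conjExponent ≠ ∞ := by
  have : r - 1 ≠ 0 := (tsub_pos_of_lt hr).ne'
  simp [ENNReal.conjExponent, this]

theorem one_le_toReal_conjExponent {r : ℝ≥0∞} (hr : 1 < r) : 1 ≤ r.conjExponent.toReal := by
  rw [← ENNReal.toReal_one]
  exact ENNReal.toReal_mono (conjExponent_ne_top hr) (one_le_conjExponent r)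

/-- The oscillation of the kernel, tested against a function whose `L^{r'}` averages over the cubes
containing a given point are controlled. -/
theorem lintegral_kernel_sub_mul_le {r : ℝ≥0∞} (hr : 1 < r)
    {K : (Fin n → ℝ) → (Fin n → ℝ) → ℝ} {H : ℝ≥0}
    (hH : HormanderBound r K H)
    {q : Triadic n} {x x' : Fin n → ℝ} (hx : x ∈ cell q) (hx' : x' ∈ cell q)
    (hKx : AEStronglyMeasurable (K x) volume) (hKx' : AEStronglyMeasurable (K x') volume)
    {φ : (Fin n → ℝ) → ℝ} (hφ : AEStronglyMeasurable φ volume) {Λ : ℝ≥0∞}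
    (hΛ : ∀ R : Cube n, x' ∈ R.toSet →
      ∫⁻ y in R.toSet, ‖φ y‖ₑ ^ r.conjExponent.toReal ≤
        Λ ^ r.conjExponent.toReal * volume R.toSet) :
    ∫⁻ y in (triple q).toSetᶜ, ‖(K x y - K x' y) * φ y‖ₑ ≤ H * Λ := by
  set p := r.conjExponent with hp
  have hp1 : 1 ≤ p.toReal := one_le_toReal_conjExponent hr
  have hp0 : p ≠ 0 := (zero_lt_one.trans_le (one_le_conjExponent r)).ne'
  have hpt : p ≠ ∞ := conjExponent_ne_top hr
  -- The factor 2 puts the cell inside Q/2 while keeping Q inside the tripled cell, so the annuli of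
  -- Q cover the complement of the latter.
  set Q := (closedCell q).dilate 2 two_pos with hQ
  have hxQ : x ∈ Q.half.toSet := mem_half_dilate_two (cell_subset_closedCell q hx)
  have hxQ' : x' ∈ Q.half.toSet := mem_half_dilate_two (cell_subset_closedCell q hx')
  have hφR : ∀ k : ℕ, eLpNorm φ p (volume.restrict ((Q.twoPow (k + 1)).toSet \ (Q.twoPow k).toSet))
      ≤ volume (Q.twoPow (k + 1)).toSet ^ (p⁻¹).toReal * Λ := by
    intro k
    refine (eLpNorm_mono_measure φ (Measure.restrict_mono sdiff_subset le_rfl)).trans ?_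
    rw [eLpNorm_eq_lintegral_rpow_enorm_toReal hp0 hpt]
    have hmem : x' ∈ (Q.twoPow (k + 1)).toSet := by
      intro i
      have h1 := hxQ' i
      have h2 : (1 : ℝ) ≤ 2 ^ (k + 1) := one_le_pow₀ one_le_two
      have h3 := Q.side_pos
      simp only [Cube.half, Cube.twoPow, Cube.dilate] at *
      nlinarith
    calc (∫⁻ y in (Q.twoPow (k + 1)).toSet, ‖φ y‖ₑ ^ p.toReal) ^ (1 / p.toReal)
        ≤ (Λ ^ p.toReal * volume (Q.twoPow (k + 1)).toSet) ^ (1 / p.toReal) :=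
          ENNReal.rpow_le_rpow (hΛ _ hmem) (by positivity)
      _ = _ := by
          rw [ENNReal.mul_rpow_of_nonneg _ _ (by positivity), ← ENNReal.rpow_mul,
            mul_one_div_cancel (by positivity), ENNReal.rpow_one, mul_comm, ENNReal.toReal_inv,
            one_div]
  have hconj : r.HolderTriple p 1 := ENNReal.HolderConjugate.conjExponent hr.le
  calc ∫⁻ y in (triple q).toSetᶜ, ‖(K x y - K x' y) * φ y‖ₑ
      ≤ ∫⁻ y in Q.toSetᶜ, ‖(K x y - K x' y) * φ y‖ₑ :=
        lintegral_mono_set (compl_subset_compl.2 (dilate_two_subset_triple q))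
    _ ≤ _ := lintegral_compl_cube_le Q _
    _ ≤ ∑' k : ℕ, (volume (Q.twoPow (k + 1)).toSet ^ (p⁻¹).toReal *
        eLpNorm (fun y => K x y - K x' y) r
          (volume.restrict ((Q.twoPow (k + 1)).toSet \ (Q.twoPow k).toSet))) * Λ := by
        refine ENNReal.tsum_le_tsum fun k => ?_
        have := eLpNorm_smul_le_mul_eLpNorm (p := r) (q := p) (r := 1)
          (μ := volume.restrict ((Q.twoPow (k + 1)).toSet \ (Q.twoPow k).toSet))
          (f := φ) (φ := fun y => K x y - K x' y) hφ.restrict (hKx.sub hKx').restrict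
        rw [eLpNorm_one_eq_lintegral_enorm] at this
        refine this.trans ((mul_le_mul_right (hφR k) _).trans (le_of_eq ?_))
        ring
    _ ≤ H * Λ := by
        rw [ENNReal.tsum_mul_right]
        exact mul_le_mul_left (hH Q x hxQ x' hxQ') _

theorem MemLinftyC.integrable {f : (Fin n → ℝ) → ℝ} (hf : MemLinftyC f) : Integrable f volume := by
  rw [← integrableOn_iff_integrable_of_support_subset (subset_tsupport f)]
  have : IsFiniteMeasure (volume.restrict (tsupport f)) :=
    ⟨by rw [Measure.restrict_apply_univ]; exact hf.2.isCompact.measure_lt_top⟩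
  exact (hf.1.restrict _).integrable le_top

/-- The operator maps mean-zero functions supported in a cell to functions that are integrable off
the tripled cell. -/
theorem lintegral_compl_triple_le {K : (Fin n → ℝ) → (Fin n → ℝ) → ℝ}
    (hK_meas : AEStronglyMeasurable (Function.uncurry K)
      ((volume : Measure (Fin n → ℝ)).prod (volume : Measure (Fin n → ℝ))))
    {T : ((Fin n → ℝ) → ℝ) → ((Fin n → ℝ) → ℝ)} (hT : IsIntegralOperator T K) {H : ℝ≥0}
    (hH : HormanderBound 1 (fun x y => K y x) H)
    {q : Triadic n} {b : (Fin n → ℝ) → ℝ} (hb : MemLinftyC b) (hbq : ∀ x ∉ cell q, b x = 0)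
    (hb0 : ∫ x, b x = 0) :
    ∫⁻ x in (triple q).toSetᶜ, ‖T b x‖ₑ ≤ H * ∫⁻ x, ‖b x‖ₑ := by
  -- The kernel is measurable only on the product, so the base point is taken among the almost all
  -- y' with a measurable section.
  obtain ⟨y', hy'q, hy'⟩ : ∃ y' ∈ cell q, AEStronglyMeasurable (fun x => K x y') volume := by
    have h1 : ∀ᵐ y', AEStronglyMeasurable (fun x => K x y') volume :=
      AEStronglyMeasurable.prodMk_left hK_meas.prod_swap
    obtain ⟨y', h2, h3⟩ := ((frequently_ae_mem_iff.2 (volume_cell_ne_zero q)).and_eventually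
      h1).exists
    exact ⟨y', h2, h3⟩
  have hts : tsupport b ⊆ (triple q).toSet := by
    refine closure_minimal (fun x hx => ?_) (triple q).isClosed_toSet
    by_contra h
    exact hx (hbq x fun h' => h (cell_subset_triple q h'))
  have hpt : ∀ᵐ x ∂volume.restrict (triple q).toSetᶜ,
      ‖T b x‖ₑ ≤ ∫⁻ y, ‖K x y - K x y'‖ₑ * ‖b y‖ₑ := by
    rw [ae_restrict_iff' (triple q).measurableSet_toSet.compl]
    filter_upwards [hT.repr b hb] with x hx hxq
    obtain ⟨hint, heq⟩ := hx fun h => hxq (hts h)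
    have : T b x = ∫ y, (K x y - K x y') * b y := by
      simp_rw [sub_mul]
      rw [integral_sub hint (hb.integrable.const_mul _), integral_const_mul, hb0, heq]
      simp
    rw [this]
    refine (enorm_integral_le_lintegral_enorm _).trans (le_of_eq ?_)
    simp_rw [enorm_mul]
  have hin : ∀ y ∈ cell q, ∫⁻ x in (triple q).toSetᶜ, ‖K x y - K x y'‖ₑ ≤ H := by
    intro y hy
    set Q := (closedCell q).dilate 2 two_pos with hQ
    have hyQ : y ∈ Q.half.toSet := mem_half_dilate_two (cell_subset_closedCell q hy)
    have hyQ' : y' ∈ Q.half.toSet := mem_half_dilate_two (cell_subset_closedCell q hy'q)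
    calc ∫⁻ x in (triple q).toSetᶜ, ‖K x y - K x y'‖ₑ
        ≤ ∫⁻ x in Q.toSetᶜ, ‖K x y - K x y'‖ₑ :=
          lintegral_mono_set (compl_subset_compl.2 (dilate_two_subset_triple q))
      _ ≤ _ := lintegral_compl_cube_le Q _
      _ ≤ H := by
          refine le_of_eq_of_le ?_ (hH Q y hyQ y' hyQ')
          refine tsum_congr fun k => ?_
          rw [eLpNorm_one_eq_lintegral_enorm]
          simp [ENNReal.conjExponent]
  calc ∫⁻ x in (triple q).toSetᶜ, ‖T b x‖ₑ
      ≤ ∫⁻ x in (triple q).toSetᶜ, ∫⁻ y, ‖K x y - K x y'‖ₑ * ‖b y‖ₑ := lintegral_mono_ae hpt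
    _ = ∫⁻ y, ∫⁻ x in (triple q).toSetᶜ, ‖K x y - K x y'‖ₑ * ‖b y‖ₑ := by
        refine lintegral_lintegral_swap ?_
        have hm : AEStronglyMeasurable (fun z : (Fin n → ℝ) × (Fin n → ℝ) =>
            K z.1 z.2 - K z.1 y') ((volume : Measure (Fin n → ℝ)).prod volume) :=
          hK_meas.sub hy'.comp_fst
        have hm2 : AEStronglyMeasurable (fun z : (Fin n → ℝ) × (Fin n → ℝ) => b z.2)
            ((volume : Measure (Fin n → ℝ)).prod volume) := hb.1.1.comp_snd
        refine AEMeasurable.mono_ac (hm.enorm.mul hm2.enorm) ?_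
        exact Measure.AbsolutelyContinuous.prod Measure.restrict_le_self.absolutelyContinuous
          Measure.AbsolutelyContinuous.rfl
    _ ≤ ∫⁻ y, H * ‖b y‖ₑ := by
        refine lintegral_mono fun y => ?_
        rw [lintegral_mul_const' _ _ enorm_ne_top]
        by_cases hy : y ∈ cell q
        · exact mul_le_mul_left (hin y hy) _
        · simp [hbq y hy]
    _ = H * ∫⁻ x, ‖b x‖ₑ := lintegral_const_mul' _ _ ENNReal.coe_ne_top

/-! ### Bounds by duality -/

theorem MemLinftyC.integrable_mul {f w : (Fin n → ℝ) → ℝ} (hf : MemLinftyC f)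
    (hw : LocallyIntegrable w volume) : Integrable (fun x => f x * w x) volume := by
  have hsub : Function.support (fun x => f x * w x) ⊆ tsupport f := fun x hx =>
    subset_tsupport f fun h => hx (by simp [h])
  rw [← integrableOn_iff_integrable_of_support_subset hsub]
  have h1 : MemLp f ∞ (volume.restrict (tsupport f)) := hf.1.restrict _
  have h2 : MemLp w 1 (volume.restrict (tsupport f)) :=
    memLp_one_iff_integrable.2 (hw.integrableOn_isCompact hf.2)
  exact h1.integrable_mul h2

theorem memLinftyC_of_bound {f : (Fin n → ℝ) → ℝ} (hf : AEStronglyMeasurable f volume)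
    {C : ℝ≥0∞} (hC : C ≠ ∞) (hfC : ∀ᵐ x, ‖f x‖ₑ ≤ C) {R : Cube n} (hR : ∀ x ∉ R.toSet, f x = 0) :
    MemLinftyC f := by
  refine ⟨⟨hf, ?_⟩, HasCompactSupport.intro R.isCompact_toSet hR⟩
  rw [eLpNorm_exponent_top]
  exact (eLpNormEssSup_le_of_ae_enorm_bound hfC).trans_lt hC.lt_top

theorem MemLinftyC.indicator {f : (Fin n → ℝ) → ℝ} (hf : MemLinftyC f) {s : Set (Fin n → ℝ)}
    (hs : MeasurableSet s) : MemLinftyC (s.indicator f) :=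
  ⟨hf.1.indicator hs, hf.2.mono fun x hx h => hx (by simp [h])⟩

theorem MemLinftyC.sub {f g : (Fin n → ℝ) → ℝ} (hf : MemLinftyC f) (hg : MemLinftyC g) :
    MemLinftyC (f - g) :=
  ⟨hf.1.sub hg.1, hf.2.sub hg.2⟩

theorem MemLinftyC.ae_bound {f : (Fin n → ℝ) → ℝ} (hf : MemLinftyC f) :
    ∃ C : ℝ≥0∞, C ≠ ∞ ∧ ∀ᵐ x, ‖f x‖ₑ ≤ C :=
  ⟨eLpNormEssSup f volume, by simpa using hf.1.2.ne, enorm_ae_le_eLpNormEssSup f volume⟩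

theorem memLinftyC_indicator_one {E : Set (Fin n → ℝ)} (hE : MeasurableSet E) {R : Cube n}
    (hER : E ⊆ R.toSet) : MemLinftyC (E.indicator fun _ => (1 : ℝ)) := by
  refine memLinftyC_of_bound (C := 1) (R := R)
    ((measurable_const.indicator hE).aestronglyMeasurable) ENNReal.one_ne_top
    (Filter.Eventually.of_forall fun x => ?_) fun x hx => indicator_of_notMem (fun h => hx (hER h)) _
  by_cases h : x ∈ E <;> simp [h]

/-- Splitting U by the sign of u gives two integrals without absolute value, hence the factor 2. An
L^1 bound for T h thereby becomes a bound for the pairings with χ_E, which can be moved to the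
transpose. -/
theorem setLIntegral_enorm_le_of_setIntegral {u : (Fin n → ℝ) → ℝ} {U : Set (Fin n → ℝ)}
    (hU : MeasurableSet U) (hu : IntegrableOn u U) {M : ℝ≥0∞}
    (hM : ∀ E ⊆ U, MeasurableSet E → ‖∫ x in E, u x‖ₑ ≤ M) : ∫⁻ x in U, ‖u x‖ₑ ≤ 2 * M := by
  obtain ⟨v, hv, huv⟩ := hu.aestronglyMeasurable
  set P : Set (Fin n → ℝ) := {x | 0 ≤ v x} with hP
  have hPm : MeasurableSet P := measurableSet_le measurable_const hv.measurable
  have hpos : ∫⁻ x in U ∩ P, ‖u x‖ₑ ≤ M := by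
    refine le_of_eq_of_le ?_ (hM _ inter_subset_left (hU.inter hPm))
    have hi : IntegrableOn u (U ∩ P) := hu.mono_set inter_subset_left
    rw [← ofReal_integral_norm_eq_lintegral_enorm hi, ← ofReal_norm]
    have h1 : ∀ᵐ x ∂volume.restrict (U ∩ P), 0 ≤ u x := by
      filter_upwards [ae_restrict_of_ae_restrict_of_subset inter_subset_left huv,
        ae_restrict_mem (hU.inter hPm)] with x hx hxP
      rw [hx]; exact hxP.2
    rw [Real.norm_of_nonneg (integral_nonneg_of_ae h1)]
    congr 1
    exact integral_congr_ae (h1.mono fun x hx => Real.norm_of_nonneg hx)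
  have hneg : ∫⁻ x in U \ P, ‖u x‖ₑ ≤ M := by
    refine le_of_eq_of_le ?_ (hM _ sdiff_subset (hU.diff hPm))
    have hi : IntegrableOn u (U \ P) := hu.mono_set sdiff_subset
    rw [← ofReal_integral_norm_eq_lintegral_enorm hi, ← ofReal_norm]
    have h1 : ∀ᵐ x ∂volume.restrict (U \ P), u x ≤ 0 := by
      filter_upwards [ae_restrict_of_ae_restrict_of_subset sdiff_subset huv,
        ae_restrict_mem (hU.diff hPm)] with x hx hxP
      rw [hx]; exact (not_le.1 hxP.2).le
    rw [Real.norm_of_nonpos (integral_nonpos_of_ae h1), ← integral_neg]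
    congr 1
    exact integral_congr_ae (h1.mono fun x hx => Real.norm_of_nonpos hx)
  rw [← lintegral_inter_add_sdiff _ U hPm, two_mul]
  exact add_le_add hpos hneg

section Operator

variable {T T' : ((Fin n → ℝ) → ℝ) → ((Fin n → ℝ) → ℝ)}

theorem IsTranspose.setIntegral_eq (hT' : IsTranspose T T') {h : (Fin n → ℝ) → ℝ}
    (hh : MemLinftyC h) {E : Set (Fin n → ℝ)} (hE : MeasurableSet E) {R : Cube n}
    (hER : E ⊆ R.toSet) :
    ∫ x in E, T h x = ∫ x, h x * T' (E.indicator fun _ => (1 : ℝ)) x := by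
  rw [← hT'.duality h _ hh (memLinftyC_indicator_one hE hER), ← integral_indicator hE]
  congr 1
  funext x
  by_cases hx : x ∈ E <;> simp [hx]

/-- The testing condition controls the operator on bounded functions supported in a cube. -/
theorem lintegral_le_of_bounded (hT' : IsTranspose T T')
    (hTl : ∀ f, MemLinftyC f → LocallyIntegrable (T f) volume) {C : ℝ≥0}
    (hC : TestingBound T' C)
    {h : (Fin n → ℝ) → ℝ} (hh : MemLinftyC h) {Λ : ℝ≥0∞} (hΛ : ∀ᵐ x, ‖h x‖ₑ ≤ Λ) {R : Cube n}
    (hR : ∀ x ∉ R.toSet, h x = 0) :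
    ∫⁻ x in R.toSet, ‖T h x‖ₑ ≤ 2 * (Λ * (C * volume R.toSet)) := by
  refine setLIntegral_enorm_le_of_setIntegral R.measurableSet_toSet
    ((hTl h hh).integrableOn_isCompact R.isCompact_toSet) fun E hER hE => ?_
  rw [hT'.setIntegral_eq hh hE hER]
  set w := T' (E.indicator fun _ => (1 : ℝ))
  have hw : AEStronglyMeasurable w volume :=
    (hT'.locallyIntegrable _ (memLinftyC_indicator_one hE hER)).aestronglyMeasurable
  calc ‖∫ x, h x * w x‖ₑ ≤ ∫⁻ x, ‖h x * w x‖ₑ := enorm_integral_le_lintegral_enorm _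
    _ = ∫⁻ x in R.toSet, ‖h x * w x‖ₑ := by
        rw [← lintegral_indicator R.measurableSet_toSet]
        congr 1
        funext x
        by_cases hx : x ∈ R.toSet
        · simp [hx]
        · simp [hx, hR x hx]
    _ ≤ ∫⁻ x in R.toSet, Λ * ‖w x‖ₑ := by
        refine lintegral_mono_ae ((ae_restrict_of_ae hΛ).mono fun x hx => ?_)
        rw [enorm_mul]
        exact mul_le_mul_left hx _
    _ = Λ * ∫⁻ x in R.toSet, ‖w x‖ₑ := lintegral_const_mul'' _ hw.enorm.restrict
    _ ≤ _ := mul_le_mul_right (hC R E hE hER) _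

/-- The operator on a function with mean zero on each cell of a disjoint family, off the tripled
cells. -/
theorem lintegral_le_of_mean_zero {K : (Fin n → ℝ) → (Fin n → ℝ) → ℝ}
    (hK_meas : AEStronglyMeasurable (Function.uncurry K)
      ((volume : Measure (Fin n → ℝ)).prod (volume : Measure (Fin n → ℝ))))
    (hT : IsIntegralOperator T K) (hT' : IsTranspose T T') {H : ℝ≥0}
    (hH : HormanderBound 1 (fun x y => K y x) H)
    {G : Set (Triadic n)} (hG : G.PairwiseDisjoint cell) {b : (Fin n → ℝ) → ℝ} (hb : MemLinftyC b)
    (hbG : ∀ x ∉ ⋃ q : G, cell q.1, b x = 0) (hb0 : ∀ q ∈ G, ∫ x in cell q, b x = 0)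
    {U : Set (Fin n → ℝ)} (hU : MeasurableSet U) {R : Cube n} (hUR : U ⊆ R.toSet)
    (hUG : ∀ q ∈ G, U ⊆ (triple q).toSetᶜ) :
    ∫⁻ x in U, ‖T b x‖ₑ ≤ 2 * (H * ∫⁻ x, ‖b x‖ₑ) := by
  refine setLIntegral_enorm_le_of_setIntegral hU
    (((hT.locallyIntegrable b hb).integrableOn_isCompact R.isCompact_toSet).mono_set hUR)
    fun E hEU hE => ?_
  have hER := hEU.trans hUR
  rw [hT'.setIntegral_eq hb hE hER]
  set w := T' (E.indicator fun _ => (1 : ℝ)) with hwdef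
  have hw : LocallyIntegrable w volume :=
    hT'.locallyIntegrable _ (memLinftyC_indicator_one hE hER)
  have hdisj : Pairwise (Function.onFun Disjoint fun q : G => cell q.1) := fun p q hpq =>
    hG p.2 q.2 fun h => hpq (Subtype.ext h)
  -- T has no continuity, so T b cannot be expanded over an infinite family. The expansion is made
  -- on the transposed side, against the fixed function w, and each term is then transposed back.
  have hsum := hasSum_integral_iUnion (f := fun x => b x * w x) (μ := volume)
    (fun q : G => measurableSet_cell q.1) hdisj (hb.integrable_mul hw).integrableOn
  have hunion : ∫ x in ⋃ q : G, cell q.1, b x * w x = ∫ x, b x * w x :=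
    setIntegral_eq_integral_of_forall_compl_eq_zero fun x hx => by rw [hbG x hx, zero_mul]
  have hterm : ∀ q : G, ‖∫ x in cell q.1, b x * w x‖ₑ ≤ H * ∫⁻ x in cell q.1, ‖b x‖ₑ := by
    intro q
    have hbq : MemLinftyC ((cell q.1).indicator b) := hb.indicator (measurableSet_cell _)
    have h1 : ∫ x in cell q.1, b x * w x = ∫ x in E, T ((cell q.1).indicator b) x := by
      rw [hT'.setIntegral_eq hbq hE hER, ← integral_indicator (measurableSet_cell _)]
      congr 1
      funext x
      by_cases hx : x ∈ cell q.1 <;> simp [hx, hwdef]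
    rw [h1]
    calc ‖∫ x in E, T ((cell q.1).indicator b) x‖ₑ
        ≤ ∫⁻ x in E, ‖T ((cell q.1).indicator b) x‖ₑ := enorm_integral_le_lintegral_enorm _
      _ ≤ ∫⁻ x in (triple q.1).toSetᶜ, ‖T ((cell q.1).indicator b) x‖ₑ :=
          lintegral_mono_set (hEU.trans (hUG q.1 q.2))
      _ ≤ H * ∫⁻ x, ‖(cell q.1).indicator b x‖ₑ :=
          lintegral_compl_triple_le hK_meas hT hH hbq (fun x hx => indicator_of_notMem hx _)
            (by rw [integral_indicator (measurableSet_cell _)]; exact hb0 q.1 q.2)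
      _ = H * ∫⁻ x in cell q.1, ‖b x‖ₑ := by
          rw [← lintegral_indicator (measurableSet_cell _)]
          simp_rw [enorm_indicator_eq_indicator_enorm]
  calc ‖∫ x, b x * w x‖ₑ = ‖∑' q : G, ∫ x in cell q.1, b x * w x‖ₑ := by
        rw [hsum.tsum_eq, hunion]
    _ ≤ ∑' q : G, ‖∫ x in cell q.1, b x * w x‖ₑ := enorm_tsum_le_tsum_enorm
    _ ≤ ∑' q : G, H * ∫⁻ x in cell q.1, ‖b x‖ₑ := ENNReal.tsum_le_tsum hterm
    _ = H * ∫⁻ x in ⋃ q : G, cell q.1, ‖b x‖ₑ := by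
        rw [ENNReal.tsum_mul_left, lintegral_iUnion (fun q : G => measurableSet_cell q.1) hdisj]
    _ ≤ H * ∫⁻ x, ‖b x‖ₑ := mul_le_mul_right (setLIntegral_le_lintegral _ _) _

end Operator

/-! ### The Calderón–Zygmund decomposition -/

/-- If t ≥ l then t / l ≥ 1, so t / l ≤ (t / l) ^ p. -/
theorem _root_.ENNReal.le_add_mul_rpow {p : ℝ} (hp : 1 ≤ p) {l : ℝ≥0∞} (hl0 : l ≠ 0) (hlt : l ≠ ∞)
    (t : ℝ≥0∞) : t ≤ l + l * (l ^ p)⁻¹ * t ^ p := by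
  rcases le_total t l with h | h
  · exact h.trans le_self_add
  · refine le_trans ?_ le_add_self
    have hs : 1 ≤ t / l := by
      rw [ENNReal.le_div_iff_mul_le (Or.inl hl0) (Or.inl hlt), one_mul]; exact h
    have h1 : t / l ≤ (t / l) ^ p := by
      simpa using ENNReal.rpow_le_rpow_of_exponent_le hs hp
    rw [ENNReal.div_rpow_of_nonneg _ _ (by positivity)] at h1
    calc t = l * (t / l) := (ENNReal.mul_div_cancel hl0 hlt).symm
      _ ≤ l * (t ^ p / l ^ p) := mul_le_mul_right h1 _
      _ = _ := by rw [div_eq_mul_inv]; ring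

/-- A substitute for Jensen's inequality, from integrating t ≤ l + l^{1-p} t^p: the constant is 1 +
c instead of c^{1/p}, and F need not be measurable. -/
theorem setLIntegral_enorm_le_of_rpow {p : ℝ} (hp : 1 ≤ p) {l : ℝ≥0∞} (hl0 : l ≠ 0) (hlt : l ≠ ∞)
    (F : (Fin n → ℝ) → ℝ) {s : Set (Fin n → ℝ)} {c : ℝ≥0∞}
    (h : ∫⁻ x in s, ‖F x‖ₑ ^ p ≤ l ^ p * (c * volume s)) :
    ∫⁻ x in s, ‖F x‖ₑ ≤ (1 + c) * l * volume s := by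
  have hp0 : 0 < p := zero_lt_one.trans_le hp
  have hlp0 : l ^ p ≠ 0 := by simp [ENNReal.rpow_eq_zero_iff, hl0, hlt]
  have hlpt : l ^ p ≠ ∞ := ENNReal.rpow_ne_top_of_nonneg hp0.le hlt
  calc ∫⁻ x in s, ‖F x‖ₑ ≤ ∫⁻ x in s, (l + l * (l ^ p)⁻¹ * ‖F x‖ₑ ^ p) :=
        lintegral_mono fun x => ENNReal.le_add_mul_rpow hp hl0 hlt _
    _ = l * volume s + l * (l ^ p)⁻¹ * ∫⁻ x in s, ‖F x‖ₑ ^ p := by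
        rw [lintegral_add_left measurable_const, lintegral_const_mul', setLIntegral_const]
        exact ENNReal.mul_ne_top hlt (ENNReal.inv_ne_top.2 hlp0)
    _ ≤ l * volume s + l * (l ^ p)⁻¹ * (l ^ p * (c * volume s)) := by gcongr
    _ = l * volume s + ((l ^ p)⁻¹ * l ^ p) * (l * (c * volume s)) := by ring
    _ = _ := by rw [ENNReal.inv_mul_cancel hlp0 hlpt]; ring

theorem volume_mul_enorm_setAverage_le {F : (Fin n → ℝ) → ℝ} {s : Set (Fin n → ℝ)}
    (hs : volume s ≠ ∞) : volume s * ‖⨍ y in s, F y‖ₑ ≤ ∫⁻ y in s, ‖F y‖ₑ := by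
  refine le_trans (le_of_eq ?_) (enorm_integral_le_lintegral_enorm _)
  rw [← measure_smul_setAverage F hs, smul_eq_mul, enorm_mul, Real.enorm_of_nonneg measureReal_nonneg,
    ofReal_measureReal hs]

/-- If a bounded function with compact support has `L^p` averages at most `l` over all small cells
that contain a point, then it is at most `l` at almost every such point. -/
theorem MemLinftyC.ae_enorm_le_of_cells {p : ℝ} (hp : 1 ≤ p) {F : (Fin n → ℝ) → ℝ}
    (hF : MemLinftyC F) (k : ℤ) {l : ℝ≥0∞} (hlt : l ≠ ∞) :
    ∀ᵐ x, (∀ q : Triadic n, q.1 ≤ k → x ∈ cell q →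
      ∫⁻ y in cell q, ‖F y‖ₑ ^ p ≤ l ^ p * volume (cell q)) → ‖F x‖ₑ ≤ l := by
  have hp0 : 0 < p := zero_lt_one.trans_le hp
  have hlpt : l ^ p ≠ ∞ := ENNReal.rpow_ne_top_of_nonneg hp0.le hlt
  have heq : ∀ x, ‖F x‖ₑ ^ p = ENNReal.ofReal (‖F x‖ ^ p) := fun x => by
    rw [← ofReal_norm, ENNReal.ofReal_rpow_of_nonneg (norm_nonneg _) hp0.le]
  obtain ⟨C, hC, hFC⟩ := hF.ae_bound
  have hmeas : AEStronglyMeasurable (fun x => ‖F x‖ ^ p) volume :=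
    (hF.1.1.norm.aemeasurable.pow_const p).aestronglyMeasurable
  have hh : MemLinftyC fun x => ‖F x‖ ^ p := by
    refine ⟨memLp_top_of_bound hmeas (C.toReal ^ p) ?_, hF.2.mono fun x hx h => hx ?_⟩
    · filter_upwards [hFC] with x hx
      rw [Real.norm_of_nonneg (by positivity)]
      refine Real.rpow_le_rpow (norm_nonneg _) ?_ hp0.le
      rw [← toReal_enorm]
      exact ENNReal.toReal_mono hC hx
    · simp [h, hp0.ne']
  filter_upwards [ae_le_of_average_le hh.integrable.locallyIntegrable k (l ^ p).toReal] with x hx hq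
  have := hx fun q hqk hxq => by
    have h1 := hq q hqk hxq
    have hv : 0 < volume.real (cell q) :=
      ENNReal.toReal_pos (volume_cell_ne_zero q) (volume_cell_ne_top q)
    rw [setAverage_eq, smul_eq_mul, inv_mul_le_iff₀ hv,
      integral_eq_lintegral_of_nonneg_ae (Filter.Eventually.of_forall fun y => by positivity)
        hmeas.restrict]
    simp_rw [← heq]
    rw [measureReal_def, mul_comm, ← ENNReal.toReal_mul]
    exact ENNReal.toReal_mono (ENNReal.mul_ne_top hlpt (volume_cell_ne_top q)) h1
  rw [← ENNReal.rpow_le_rpow_iff hp0, heq]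
  exact (ENNReal.ofReal_le_iff_le_toReal hlpt).2 this

/-- The Calderón–Zygmund decomposition of a function supported in a tripled cell, at a height above
its `L^p` average. -/
theorem exists_calderonZygmund {p : ℝ} (hp : 1 ≤ p) {F : (Fin n → ℝ) → ℝ} (hF : MemLinftyC F)
    {q₀ : Triadic n} (hFq : ∀ x ∉ (triple q₀).toSet, F x = 0) {l : ℝ≥0∞} (hl0 : l ≠ 0)
    (hlt : l ≠ ∞) (hl : ∫⁻ x, ‖F x‖ₑ ^ p ≤ l ^ p * volume (cell q₀)) :
    ∃ (G : Set (Triadic n)) (g b : (Fin n → ℝ) → ℝ), G.PairwiseDisjoint cell ∧ F = g + b ∧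
      MemLinftyC g ∧ MemLinftyC b ∧ (∀ᵐ x, ‖g x‖ₑ ≤ (1 + 3 ^ n) * l) ∧
      (∀ x ∉ ((closedCell q₀).dilate 5 (by norm_num)).toSet, g x = 0) ∧
      (∀ x ∉ ⋃ q : G, cell q.1, b x = 0) ∧ (∀ q ∈ G, ∫ x in cell q, b x = 0) ∧
      ∫⁻ x, ‖b x‖ₑ ≤ 2 * ((1 + 3 ^ n) * l) * ∑' q : G, volume (cell q.1) ∧
      l ^ p * ∑' q : G, volume (cell q.1) ≤ ∫⁻ x, ‖F x‖ₑ ^ p ∧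
      ∀ q : Triadic n, q.1 ≤ q₀.1 → ∀ x ∈ (triple q).toSet, (∀ q' ∈ G, x ∉ (triple q').toSet) →
        ∫⁻ y in cell q, ‖F y‖ₑ ^ p ≤ l ^ p * volume (cell q) := by
  have hp0 : 0 < p := zero_lt_one.trans_le hp
  set P : Set (Triadic n) :=
    {q | q.1 ≤ q₀.1 ∧ l ^ p * volume (cell q) < ∫⁻ y in cell q, ‖F y‖ₑ ^ p} with hP
  set G := maximalCells P with hGdef
  have hGP : G ⊆ P := maximalCells_subset P
  have hG : G.PairwiseDisjoint cell := pairwiseDisjoint_maximalCells P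
  -- A cell of the generation of q₀ has the volume of q₀, so `hl` keeps it out of `P`. Hence the
  -- parent of a selected cell still satisfies the generation bound in `P`, and can fail only the
  -- inequality.
  have hlevel : ∀ q ∈ P, q.1 < q₀.1 := by
    refine fun q hq => lt_of_le_of_ne hq.1 fun h => ?_
    have h1 : volume (cell q) = volume (cell q₀) := by rw [volume_cell, volume_cell, h]
    exact absurd (hq.2.trans_le ((setLIntegral_le_lintegral _ _).trans (hl.trans_eq (by rw [h1]))))
      (lt_irrefl _)
  have hpar : ∀ q ∈ G, ∫⁻ y in cell q, ‖F y‖ₑ ^ p ≤ l ^ p * (3 ^ n * volume (cell q)) := by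
    intro q hq
    have h1 : parent q ∉ P := parent_notMem_of_mem_maximalCells hq
    have h2 : ¬ l ^ p * volume (cell (parent q)) < ∫⁻ y in cell (parent q), ‖F y‖ₑ ^ p :=
      fun h => h1 ⟨by have := hlevel q (hGP hq); simp only [parent]; lia, h⟩
    rw [← volume_parent]
    exact (lintegral_mono_set (cell_subset_parent q)).trans (not_lt.1 h2)
  have hL1 : ∀ q ∈ G, ∫⁻ y in cell q, ‖F y‖ₑ ≤ (1 + 3 ^ n) * l * volume (cell q) :=
    fun q hq => setLIntegral_enorm_le_of_rpow hp hl0 hlt F (hpar q hq)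
  have havg : ∀ q ∈ G, ‖⨍ y in cell q, F y‖ₑ ≤ (1 + 3 ^ n) * l := by
    intro q hq
    have h1 := (volume_mul_enorm_setAverage_le (F := F) (volume_cell_ne_top q)).trans (hL1 q hq)
    rw [mul_comm] at h1
    exact (ENNReal.mul_le_mul_iff_left (volume_cell_ne_zero q) (volume_cell_ne_top q)).1 h1
  classical
  set g : (Fin n → ℝ) → ℝ := fun x =>
    if h : ∃ q ∈ G, x ∈ cell q then ⨍ y in cell h.choose, F y else F x with hg
  have hg_in : ∀ q ∈ G, ∀ x ∈ cell q, g x = ⨍ y in cell q, F y := by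
    intro q hq x hx
    have hex : ∃ q ∈ G, x ∈ cell q := ⟨q, hq, hx⟩
    have : hex.choose = q :=
      hG.elim_set hex.choose_spec.1 hq x hex.choose_spec.2 hx
    simp only [hg, hex, dif_pos, this]
  have hg_out : ∀ x ∉ ⋃ q : G, cell q.1, g x = F x := by
    intro x hx
    have hex : ¬ ∃ q ∈ G, x ∈ cell q := fun ⟨q, hq, hxq⟩ => hx (mem_iUnion.2 ⟨⟨q, hq⟩, hxq⟩)
    simp only [hg, hex, dif_neg, not_false_eq_true]
  have hAm : MeasurableSet (⋃ q : G, cell q.1) :=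
    MeasurableSet.iUnion fun q => measurableSet_cell q.1
  have hdisj : Pairwise (Function.onFun Disjoint fun q : G => cell q.1) := fun p q hpq =>
    hG p.2 q.2 fun h => hpq (Subtype.ext h)
  have hg_meas : AEStronglyMeasurable g volume := by
    rw [← Measure.restrict_univ (μ := volume), ← union_compl_self (⋃ q : G, cell q.1),
      aestronglyMeasurable_union_iff]
    constructor
    · rw [aestronglyMeasurable_iUnion_iff]
      refine fun q => aestronglyMeasurable_const (b := ⨍ y in cell q.1, F y) |>.congr ?_
      filter_upwards [ae_restrict_mem (measurableSet_cell q.1)] with x hx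
      exact (hg_in q.1 q.2 x hx).symm
    · refine hF.1.1.restrict.congr ?_
      filter_upwards [ae_restrict_mem hAm.compl] with x hx
      exact (hg_out x hx).symm
  have hg_bound : ∀ᵐ x, ‖g x‖ₑ ≤ (1 + 3 ^ n) * l := by
    filter_upwards [hF.ae_enorm_le_of_cells hp q₀.1 hlt] with x hx
    by_cases hxA : x ∈ ⋃ q : G, cell q.1
    · obtain ⟨⟨q, hq⟩, hxq⟩ := mem_iUnion.1 hxA
      rw [hg_in q hq x hxq]
      exact havg q hq
    · rw [hg_out x hxA]
      refine (hx fun q hqk hxq => not_lt.1 fun h => ?_).trans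
        (le_mul_of_one_le_left zero_le le_self_add)
      obtain ⟨q', hq', hqq', -⟩ := exists_mem_maximalCells (P := P) (fun q hq => hq.1) ⟨hqk, h⟩
      exact hxA (mem_iUnion.2 ⟨⟨q', hq'⟩, hqq' hxq⟩)
  have hg_supp : ∀ x ∉ ((closedCell q₀).dilate 5 (by norm_num)).toSet, g x = 0 := by
    intro x hx
    have h3 := (closedCell q₀).side_pos
    by_cases hxA : x ∈ ⋃ q : G, cell q.1
    · exfalso
      obtain ⟨⟨q, hq⟩, hxq⟩ := mem_iUnion.1 hxA
      -- A selected cell has side at most that of q₀; if it reached outside 5q₀ it would miss 3q₀,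
      -- where F lives, and could not have been selected.
      have hz : ∀ y ∈ cell q, F y = 0 := by
        intro y hy
        refine hFq y fun hy3 => hx fun i => ?_
        have h1 := hy3 i
        have h2 := cell_subset_closedCell q hxq i
        have h4 := cell_subset_closedCell q hy i
        have h5 : (3 : ℝ) ^ q.1 ≤ 3 ^ q₀.1 := zpow_le_zpow_right₀ (by norm_num) (hGP hq).1
        simp only [closedCell, triple, Cube.dilate] at *
        rw [abs_le] at *
        constructor <;> linarith
      have h6 : ∫⁻ y in cell q, ‖F y‖ₑ ^ p = 0 := by
        rw [setLIntegral_congr_fun (g := fun _ => 0) (measurableSet_cell q) fun y hy => by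
          simp [hz y hy, hp0]]
        simp
      have h7 := (hGP hq).2
      rw [h6] at h7
      exact not_lt_zero h7
    · rw [hg_out x hxA]
      refine hFq x fun h => hx fun i => ?_
      have := h i
      simp only [triple, Cube.dilate] at *
      linarith
  have hLl : (1 + 3 ^ n) * l ≠ ∞ := ENNReal.mul_ne_top (by finiteness) hlt
  have hgL : MemLinftyC g := memLinftyC_of_bound hg_meas hLl hg_bound hg_supp
  have hb_out : ∀ x ∉ ⋃ q : G, cell q.1, (F - g) x = 0 := fun x hx => by
    rw [Pi.sub_apply, hg_out x hx, sub_self]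
  refine ⟨G, g, F - g, hG, by simp, hgL, hF.sub hgL, hg_bound, hg_supp, hb_out,
    ?_, ?_, ?_, ?_⟩
  · intro q hq
    have h1 : ∫ x in cell q, (F - g) x = ∫ x in cell q, (F x - ⨍ y in cell q, F y) :=
      setIntegral_congr_fun (measurableSet_cell q) fun x hx => by
        simp only [Pi.sub_apply, hg_in q hq x hx]
    rw [h1, integral_sub hF.integrable.integrableOn, setIntegral_const,
      measure_smul_setAverage _ (volume_cell_ne_top q), sub_self]
    have : IsFiniteMeasure (volume.restrict (cell q)) :=
      ⟨by rw [Measure.restrict_apply_univ]; exact (volume_cell_ne_top q).lt_top⟩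
    exact integrable_const _
  · have h1 : ∫⁻ x, ‖(F - g) x‖ₑ = ∫⁻ x in ⋃ q : G, cell q.1, ‖(F - g) x‖ₑ := by
      rw [← lintegral_indicator hAm]
      congr 1
      funext x
      by_cases hx : x ∈ ⋃ q : G, cell q.1
      · rw [indicator_of_mem hx]
      · rw [indicator_of_notMem hx, hb_out x hx, enorm_zero]
    rw [h1, lintegral_iUnion (fun q : G => measurableSet_cell q.1) hdisj, ← ENNReal.tsum_mul_left]
    refine ENNReal.tsum_le_tsum fun q => ?_
    calc ∫⁻ x in cell q.1, ‖(F - g) x‖ₑ ≤ ∫⁻ x in cell q.1, (‖F x‖ₑ + ‖g x‖ₑ) :=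
          lintegral_mono fun x => enorm_sub_le
      _ = (∫⁻ x in cell q.1, ‖F x‖ₑ) + ∫⁻ x in cell q.1, ‖g x‖ₑ :=
          lintegral_add_left' hF.1.1.enorm.restrict _
      _ ≤ (1 + 3 ^ n) * l * volume (cell q.1) + (1 + 3 ^ n) * l * volume (cell q.1) := by
          refine add_le_add (hL1 q.1 q.2) ?_
          rw [← setLIntegral_const]
          exact lintegral_mono_ae (ae_restrict_of_ae hg_bound)
      _ = _ := by ring
  · calc l ^ p * ∑' q : G, volume (cell q.1)
        ≤ ∑' q : G, ∫⁻ x in cell q.1, ‖F x‖ₑ ^ p := by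
          rw [← ENNReal.tsum_mul_left]
          exact ENNReal.tsum_le_tsum fun q => (hGP q.2).2.le
      _ = ∫⁻ x in ⋃ q : G, cell q.1, ‖F x‖ₑ ^ p :=
          (lintegral_iUnion (fun q : G => measurableSet_cell q.1) hdisj _).symm
      _ ≤ _ := setLIntegral_le_lintegral _ _
  -- A cell with a large average lies in a selected one, and triples respect this inclusion. The
  -- triples removed for the bad part of T F therefore also take care of the maximal function.
  · intro q hqk x hxq hxG
    refine not_lt.1 fun h => ?_
    obtain ⟨q', hq', hqq', hle⟩ :=
      exists_mem_maximalCells (P := P) (fun q hq => hq.1) ⟨hqk, h⟩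
    exact hxG q' hq' (triple_subset_triple hqq' hle hxq)

/-! ### The local estimate -/

theorem cubeAvg_rpow_mul {p : ℝ} (hp : 0 < p) (f : (Fin n → ℝ) → ℝ) (Q : Cube n) :
    cubeAvg p f Q ^ p * volume Q.toSet = ∫⁻ x in Q.toSet, ‖f x‖ₑ ^ p := by
  rw [cubeAvg, ← ENNReal.rpow_mul, one_div_mul_cancel hp.ne', ENNReal.rpow_one, mul_right_comm,
    ENNReal.inv_mul_cancel Q.volume_toSet_ne_zero Q.volume_toSet_ne_top, one_mul]

theorem MemLinftyC.cubeAvg_ne_top {p : ℝ} (hp : 0 < p) {f : (Fin n → ℝ) → ℝ} (hf : MemLinftyC f)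
    (Q : Cube n) : cubeAvg p f Q ≠ ∞ := by
  obtain ⟨C, hC, hfC⟩ := hf.ae_bound
  refine ENNReal.rpow_ne_top_of_nonneg (by positivity)
    (ENNReal.mul_ne_top (ENNReal.inv_ne_top.2 Q.volume_toSet_ne_zero) ?_)
  have : ∫⁻ x in Q.toSet, ‖f x‖ₑ ^ p ≤ C ^ p * volume Q.toSet := by
    rw [← setLIntegral_const]
    exact lintegral_mono_ae ((ae_restrict_of_ae hfC).mono fun x hx =>
      ENNReal.rpow_le_rpow hx hp.le)
  exact ne_top_of_le_ne_top
    (ENNReal.mul_ne_top (ENNReal.rpow_ne_top_of_nonneg hp.le hC) Q.volume_toSet_ne_top) this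

theorem lintegral_indicator_rpow {p : ℝ} (hp : 0 < p) (f : (Fin n → ℝ) → ℝ)
    {s : Set (Fin n → ℝ)} (hs : MeasurableSet s) :
    ∫⁻ x, ‖s.indicator f x‖ₑ ^ p = ∫⁻ x in s, ‖f x‖ₑ ^ p := by
  rw [← lintegral_indicator hs]
  congr 1
  funext x
  by_cases hx : x ∈ s <;> simp [hx, hp]

theorem IsIntegralOperator.ae_eq_zero {T : ((Fin n → ℝ) → ℝ) → ((Fin n → ℝ) → ℝ)}
    {K : (Fin n → ℝ) → (Fin n → ℝ) → ℝ} (hT : IsIntegralOperator T K) {f : (Fin n → ℝ) → ℝ}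
    (hf : MemLinftyC f) (h0 : f =ᵐ[volume] 0) : T f =ᵐ[volume] 0 := by
  have h1 : MemLinftyC ((0 : ℝ) • f) := by
    rw [zero_smul]; exact ⟨MemLp.zero, HasCompactSupport.zero⟩
  have h2 : f =ᵐ[volume] (0 : ℝ) • f := by rw [zero_smul]; exact h0
  have h3 := (hT.congr_ae f _ hf h1 h2).trans (hT.map_smul 0 f hf)
  rwa [zero_smul] at h3

/-- If the `L^p` averages over all cells of generation at most that of `q₀` whose triple contains
`x` are controlled, so are those over all cubes containing `x`. -/
theorem lintegral_cube_le_of_cells {p : ℝ} {F : (Fin n → ℝ) → ℝ} {q₀ : Triadic n} {M : ℝ≥0∞}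
    (hM : ∫⁻ x, ‖F x‖ₑ ^ p ≤ M * volume (cell q₀)) {x : Fin n → ℝ}
    (hx : ∀ q : Triadic n, q.1 ≤ q₀.1 → x ∈ (triple q).toSet →
      ∫⁻ y in cell q, ‖F y‖ₑ ^ p ≤ M * volume (cell q)) (R : Cube n) (hxR : x ∈ R.toSet) :
    ∫⁻ y in R.toSet, ‖F y‖ₑ ^ p ≤ 9 ^ n * M * volume R.toSet := by
  -- R is covered by cells of generation j + 1. In 9 ^ n, one factor 3 ^ n counts these cells and
  -- the other compares their volume with that of R.
  obtain ⟨j, hj1, hj2⟩ := exists_mem_Ioc_zpow R.side_pos (show (1 : ℝ) < 3 by norm_num)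
  have hvol : ENNReal.ofReal (3 ^ (j + 1)) ^ n ≤ 3 ^ n * volume R.toSet := by
    rw [R.volume_toSet, ← mul_pow, ← ENNReal.ofReal_ofNat 3, ← ENNReal.ofReal_mul (by norm_num)]
    refine pow_le_pow_left₀ zero_le (ENNReal.ofReal_le_ofReal ?_) _
    rw [zpow_add_one₀ (by norm_num)]
    linarith
  calc ∫⁻ y in R.toSet, ‖F y‖ₑ ^ p
      ≤ 3 ^ n * (M * ENNReal.ofReal (3 ^ (j + 1)) ^ n) := by
        refine lintegral_cube_le hj2 hxR _ fun q hq hxq => ?_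
        have hv : volume (cell q) = ENNReal.ofReal (3 ^ (j + 1)) ^ n := by rw [volume_cell, hq]
        rw [← hv]
        rcases le_total q.1 q₀.1 with h | h
        · exact hx q h hxq
        · refine (setLIntegral_le_lintegral _ _).trans (hM.trans (mul_le_mul_right ?_ _))
          rw [volume_cell, volume_cell]
          exact pow_le_pow_left₀ zero_le
            (ENNReal.ofReal_le_ofReal (zpow_le_zpow_right₀ (by norm_num) h)) _
    _ ≤ 3 ^ n * (M * (3 ^ n * volume R.toSet)) := by gcongr
    _ = 9 ^ n * M * volume R.toSet := by
        rw [show (9 : ℝ≥0∞) = 3 * 3 by norm_num, mul_pow]; ring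

/-- The exceptional set of the local estimate on a cell: off a small set, both the operator and the
maximal function of order `p` are controlled by the average on the tripled cell. -/
def HasExceptionalSets (T : ((Fin n → ℝ) → ℝ) → ((Fin n → ℝ) → ℝ)) (p : ℝ) (B : ℝ≥0) : Prop :=
  ∀ f : (Fin n → ℝ) → ℝ, MemLinftyC f → ∀ q : Triadic n, ∃ Ω : Set (Fin n → ℝ),
    MeasurableSet Ω ∧ 4 * 3 ^ n * volume Ω ≤ volume (cell q) ∧
    (∀ᵐ x, x ∈ cell q → x ∉ Ω →
      ‖T ((triple q).toSet.indicator f) x‖ₑ ≤ B * cubeAvg p f (triple q)) ∧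
    ∀ x ∈ cell q, x ∉ Ω → ∀ R : Cube n, x ∈ R.toSet →
      ∫⁻ y in R.toSet, ‖(triple q).toSet.indicator f y‖ₑ ^ p ≤
        (B * cubeAvg p f (triple q)) ^ p * volume R.toSet

/-- A quantitative version of the weak type estimate at a given height, from the
Calderón–Zygmund decomposition. -/
theorem exists_lintegral_le_off_small_set {K : (Fin n → ℝ) → (Fin n → ℝ) → ℝ}
    (hK_meas : AEStronglyMeasurable (Function.uncurry K)
      ((volume : Measure (Fin n → ℝ)).prod (volume : Measure (Fin n → ℝ))))
    {T T' : ((Fin n → ℝ) → ℝ) → ((Fin n → ℝ) → ℝ)} (hT : IsIntegralOperator T K)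
    (hT' : IsTranspose T T') {H C : ℝ≥0} (hH : HormanderBound 1 (fun x y => K y x) H)
    (hC : TestingBound T' C) {p : ℝ} (hp : 1 ≤ p) {F : (Fin n → ℝ) → ℝ} (hF : MemLinftyC F)
    {q : Triadic n} (hFq : ∀ x ∉ (triple q).toSet, F x = 0) {l : ℝ≥0∞} (hl0 : l ≠ 0)
    (hlt : l ≠ ∞) {c : ℝ≥0∞} (hc : 1 ≤ c)
    (hl : c * ∫⁻ x, ‖F x‖ₑ ^ p ≤ l ^ p * volume (cell q)) :
    ∃ Ω : Set (Fin n → ℝ), MeasurableSet Ω ∧ c * volume Ω ≤ 3 ^ n * volume (cell q) ∧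
      ∫⁻ x in cell q \ Ω, ‖T F x‖ₑ ≤
        (2 * (1 + 3 ^ n) * C * 5 ^ n + 4 * (1 + 3 ^ n) * H) * l * volume (cell q) ∧
      ∀ q' : Triadic n, q'.1 ≤ q.1 → ∀ x ∈ (triple q').toSet, x ∉ Ω →
        ∫⁻ y in cell q', ‖F y‖ₑ ^ p ≤ l ^ p * volume (cell q') := by
  have hp0 : 0 < p := zero_lt_one.trans_le hp
  have hlp0 : l ^ p ≠ 0 := by simp [ENNReal.rpow_eq_zero_iff, hl0, hlt]
  have hlpt : l ^ p ≠ ∞ := ENNReal.rpow_ne_top_of_nonneg hp0.le hlt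
  obtain ⟨G, g, b, hG, hFgb, hg, hb, hgl, hgs, hbs, hb0, hbl, hGl, hmax⟩ :=
    exists_calderonZygmund hp hF hFq hl0 hlt ((le_mul_of_one_le_left zero_le hc).trans hl)
  set σ := ∑' q : G, volume (cell q.1) with hσ
  have hcσ : c * σ ≤ volume (cell q) := by
    have h1 : l ^ p * (c * σ) ≤ l ^ p * volume (cell q) := by
      refine le_trans ?_ hl
      rw [mul_left_comm]
      exact mul_le_mul_right hGl _
    exact (ENNReal.mul_le_mul_iff_right hlp0 hlpt).1 h1
  set Ω : Set (Fin n → ℝ) := ⋃ q' : G, (triple q'.1).toSet with hΩ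
  have hΩm : MeasurableSet Ω := MeasurableSet.iUnion fun q' => (triple q'.1).measurableSet_toSet
  refine ⟨Ω, hΩm, ?_, ?_, fun q' hq' x hx hxΩ => hmax q' hq' x hx fun q'' hq'' h =>
    hxΩ (mem_iUnion.2 ⟨⟨q'', hq''⟩, h⟩)⟩
  · calc c * volume Ω ≤ c * ∑' q' : G, volume (triple q'.1).toSet := by
          gcongr; exact measure_iUnion_le _
      _ = 3 ^ n * (c * σ) := by
          simp_rw [volume_triple]
          rw [ENNReal.tsum_mul_left]
          ring
      _ ≤ 3 ^ n * volume (cell q) := by gcongr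
  · have hTF : ∀ᵐ x, ‖T F x‖ₑ ≤ ‖T g x‖ₑ + ‖T b x‖ₑ := by
      filter_upwards [hT.map_add g b hg hb] with x hx
      rw [hFgb, hx]
      exact enorm_add_le _ _
    -- The good part g lives on 5q, so the testing condition is applied there; this is the origin of
    -- 5 ^ n.
    set R := (closedCell q).dilate 5 (by norm_num) with hR
    have hqR : cell q ⊆ R.toSet := by
      intro x hx i
      have h1 := cell_subset_closedCell q hx i
      have h2 := (closedCell q).side_pos
      simp only [hR, Cube.dilate]
      linarith
    have h1 : ∫⁻ x in cell q \ Ω, ‖T g x‖ₑ ≤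
        2 * (((1 + 3 ^ n) * l) * (C * (5 ^ n * volume (cell q)))) := by
      have := lintegral_le_of_bounded hT' hT.locallyIntegrable hC hg hgl hgs
      rw [Cube.volume_dilate, volume_closedCell, ENNReal.ofReal_ofNat] at this
      exact (lintegral_mono_set (sdiff_subset.trans hqR)).trans this
    have h2 : ∫⁻ x in cell q \ Ω, ‖T b x‖ₑ ≤
        2 * (H * (2 * ((1 + 3 ^ n) * l) * volume (cell q))) := by
      have := lintegral_le_of_mean_zero hK_meas hT hT' hH hG hb hbs hb0
        ((measurableSet_cell q).diff hΩm) (sdiff_subset.trans hqR)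
        (fun q' hq' x hx hx' => hx.2 (mem_iUnion.2 ⟨⟨q', hq'⟩, hx'⟩))
      refine this.trans ?_
      gcongr
      refine hbl.trans ?_
      gcongr
      exact (le_mul_of_one_le_left zero_le hc).trans hcσ
    calc ∫⁻ x in cell q \ Ω, ‖T F x‖ₑ
        ≤ ∫⁻ x in cell q \ Ω, (‖T g x‖ₑ + ‖T b x‖ₑ) := lintegral_mono_ae (ae_restrict_of_ae hTF)
      _ = (∫⁻ x in cell q \ Ω, ‖T g x‖ₑ) + ∫⁻ x in cell q \ Ω, ‖T b x‖ₑ :=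
          lintegral_add_left' (hT.locallyIntegrable g hg).aestronglyMeasurable.enorm.restrict _
      _ ≤ _ := add_le_add h1 h2
      _ = _ := by ring

theorem exists_hasExceptionalSets {K : (Fin n → ℝ) → (Fin n → ℝ) → ℝ}
    (hK_meas : AEStronglyMeasurable (Function.uncurry K)
      ((volume : Measure (Fin n → ℝ)).prod (volume : Measure (Fin n → ℝ))))
    {T T' : ((Fin n → ℝ) → ℝ) → ((Fin n → ℝ) → ℝ)} (hT : IsIntegralOperator T K)
    (hT' : IsTranspose T T') {H C : ℝ≥0} (hH : HormanderBound 1 (fun x y => K y x) H)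
    (hC : TestingBound T' C) {p : ℝ} (hp : 1 ≤ p) : ∃ B : ℝ≥0, HasExceptionalSets T p B := by
  have hp0 : 0 < p := zero_lt_one.trans_le hp
  -- Ω₁ will satisfy c|Ω₁| ≤ 3^n|q|, so this c gives 8·3^n|Ω₁| ≤ |q|. The factor 3 ^ n in d is
  -- |3q|/|q|, so that the height l = d·A is admissible. M is the L^1 constant, with 1 added to make
  -- it nonzero. In the final constant the first summand serves Chebyshev's inequality and the
  -- second the maximal function.
  set c : ℝ≥0 := 8 * 9 ^ n with hc
  set d : ℝ≥0 := 3 ^ n * c with hd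
  set M : ℝ≥0 := 2 * (1 + 3 ^ n) * C * 5 ^ n + 4 * (1 + 3 ^ n) * H + 1 with hM
  refine ⟨8 * 3 ^ n * (M * d) + 9 ^ n * d, fun f hf q => ?_⟩
  set B : ℝ≥0 := 8 * 3 ^ n * (M * d) + 9 ^ n * d with hB
  set A := cubeAvg p f (triple q) with hA
  set F := (triple q).toSet.indicator f with hFdef
  have hF : MemLinftyC F := hf.indicator (triple q).measurableSet_toSet
  have hAt : A ≠ ∞ := hf.cubeAvg_ne_top hp0 _
  have hFA : ∫⁻ x, ‖F x‖ₑ ^ p = A ^ p * (3 ^ n * volume (cell q)) := by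
    rw [hFdef, lintegral_indicator_rpow hp0 f (triple q).measurableSet_toSet,
      ← cubeAvg_rpow_mul hp0, volume_triple]
  -- The decomposition needs a positive height; if the average is zero then F and T F vanish a.e.
  by_cases hA0 : A = 0
  · have h0 : ∫⁻ x, ‖F x‖ₑ ^ p = 0 := by rw [hFA, hA0, ENNReal.zero_rpow_of_pos hp0, zero_mul]
    have hF0 : F =ᵐ[volume] 0 := by
      rw [lintegral_eq_zero_iff' (hF.1.1.enorm.pow_const p)] at h0
      filter_upwards [h0] with x hx
      simpa [ENNReal.rpow_eq_zero_iff, hp0, hp0.not_gt] using hx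
    refine ⟨∅, MeasurableSet.empty, by simp, ?_, fun x _ _ R _ => ?_⟩
    · filter_upwards [hT.ae_eq_zero hF hF0] with x hx _ _
      rw [hx]; simp
    · exact (setLIntegral_le_lintegral _ _).trans (h0.trans_le zero_le)
  have h3 : (1 : ℝ≥0∞) ≤ 3 ^ n := one_le_pow₀ (by norm_num)
  have hc1 : (1 : ℝ≥0) ≤ c := by
    rw [hc]
    exact one_le_mul_of_one_le_of_one_le (by norm_num) (one_le_pow₀ (by norm_num))
  have hd1 : (1 : ℝ≥0) ≤ d := by
    rw [hd]
    exact one_le_mul_of_one_le_of_one_le (one_le_pow₀ (by norm_num)) hc1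
  set l : ℝ≥0∞ := d * A with hl
  have hl0 : l ≠ 0 := mul_ne_zero (by simpa using (zero_lt_one.trans_le hd1).ne') hA0
  have hlt : l ≠ ∞ := ENNReal.mul_ne_top ENNReal.coe_ne_top hAt
  have hdp : (d : ℝ≥0∞) ≤ (d : ℝ≥0∞) ^ p := by
    simpa using ENNReal.rpow_le_rpow_of_exponent_le (x := (d : ℝ≥0∞)) (by exact_mod_cast hd1) hp
  have hcl : (c : ℝ≥0∞) * ∫⁻ x, ‖F x‖ₑ ^ p ≤ l ^ p * volume (cell q) := by
    rw [hFA, hl, ENNReal.mul_rpow_of_nonneg _ _ hp0.le]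
    calc (c : ℝ≥0∞) * (A ^ p * (3 ^ n * volume (cell q)))
        = (d : ℝ≥0∞) * A ^ p * volume (cell q) := by rw [hd]; push_cast; ring
      _ ≤ _ := by gcongr
  obtain ⟨Ω₁, hΩ₁m, hΩ₁v, hTF, hmax⟩ := exists_lintegral_le_off_small_set hK_meas hT hT' hH hC hp
    hF (fun x hx => indicator_of_notMem hx f) hl0 hlt (by exact_mod_cast hc1) hcl
  have hTFm : AEStronglyMeasurable (T F) volume := (hT.locallyIntegrable F hF).aestronglyMeasurable
  obtain ⟨v, hv, hTv⟩ := hTFm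
  set Ω₂ : Set (Fin n → ℝ) := {x ∈ cell q \ Ω₁ | B * A ≤ ‖v x‖ₑ} with hΩ₂
  have hΩ₂m : MeasurableSet Ω₂ :=
    ((measurableSet_cell q).diff hΩ₁m).inter (measurableSet_le measurable_const hv.enorm)
  have hΩ₂v : 8 * 3 ^ n * volume Ω₂ ≤ volume (cell q) := by
    have h1 : B * A * volume Ω₂ ≤ ∫⁻ x in cell q \ Ω₁, ‖T F x‖ₑ := by
      rw [← setLIntegral_const]
      calc ∫⁻ x in Ω₂, B * A ≤ ∫⁻ x in Ω₂, ‖T F x‖ₑ := by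
            refine lintegral_mono_ae ?_
            filter_upwards [ae_restrict_mem hΩ₂m, ae_restrict_of_ae hTv] with x hx hxv
            rw [hxv]; exact hx.2
        _ ≤ _ := lintegral_mono_set fun x hx => hx.1
    have hMl : (M : ℝ≥0∞) * l ≠ 0 := mul_ne_zero (by simp [hM]) hl0
    have hMlt : (M : ℝ≥0∞) * l ≠ ∞ := ENNReal.mul_ne_top ENNReal.coe_ne_top hlt
    have h2 : M * l * (8 * 3 ^ n * volume Ω₂) ≤ M * l * volume (cell q) := by
      calc M * l * (8 * 3 ^ n * volume Ω₂) = (8 * 3 ^ n * (M * d)) * A * volume Ω₂ := by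
            rw [hl]; ring
        _ ≤ B * A * volume Ω₂ := by
            gcongr
            rw [hB]; push_cast; exact le_self_add
        _ ≤ _ := h1.trans hTF
        _ ≤ M * l * volume (cell q) := by
            gcongr
            rw [hM]; push_cast; exact le_self_add
    exact (ENNReal.mul_le_mul_iff_right hMl hMlt).1 h2
  refine ⟨Ω₁ ∪ Ω₂, hΩ₁m.union hΩ₂m, ?_, ?_, ?_⟩
  · have h1 : 8 * 3 ^ n * volume Ω₁ ≤ volume (cell q) := by
      have h0 : (3 : ℝ≥0∞) ^ n ≠ 0 := by simp
      refine (ENNReal.mul_le_mul_iff_right h0 (by finiteness)).1 (le_trans (le_of_eq ?_) hΩ₁v)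
      rw [hc]; push_cast
      rw [show (9 : ℝ≥0∞) = 3 * 3 by norm_num, mul_pow]; ring
    have h2 : 2 * (4 * 3 ^ n * volume (Ω₁ ∪ Ω₂)) ≤ 2 * volume (cell q) := by
      calc 2 * (4 * 3 ^ n * volume (Ω₁ ∪ Ω₂))
          ≤ 2 * (4 * 3 ^ n * (volume Ω₁ + volume Ω₂)) := by gcongr; exact measure_union_le _ _
        _ = 8 * 3 ^ n * volume Ω₁ + 8 * 3 ^ n * volume Ω₂ := by ring
        _ ≤ volume (cell q) + volume (cell q) := add_le_add h1 hΩ₂v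
        _ = _ := by ring
    exact (ENNReal.mul_le_mul_iff_right two_ne_zero ENNReal.ofNat_ne_top).1 h2
  · filter_upwards [hTv] with x hx hxq hxΩ
    rw [hx]
    by_contra h
    exact hxΩ (Or.inr ⟨⟨hxq, fun h' => hxΩ (Or.inl h')⟩, (not_le.1 h).le⟩)
  · intro x hxq hxΩ R hxR
    refine (lintegral_cube_le_of_cells (le_trans (le_mul_of_one_le_left zero_le
      (by exact_mod_cast hc1)) hcl) (fun q' hq' hxq' => hmax q' hq' x hxq' fun h =>
        hxΩ (Or.inl h)) R hxR).trans ?_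
    gcongr
    calc (9 : ℝ≥0∞) ^ n * l ^ p ≤ ((9 : ℝ≥0∞) ^ n) ^ p * l ^ p := by
          gcongr
          simpa using ENNReal.rpow_le_rpow_of_exponent_le (x := (9 : ℝ≥0∞) ^ n)
            (one_le_pow₀ (by norm_num)) hp
      _ = ((9 : ℝ≥0∞) ^ n * l) ^ p := (ENNReal.mul_rpow_of_nonneg _ _ hp0.le).symm
      _ ≤ (B * A) ^ p := by
          refine ENNReal.rpow_le_rpow ?_ hp0.le
          rw [hl, ← mul_assoc]
          gcongr
          rw [hB]; push_cast; exact le_add_self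

/-! ### One step of the sparse domination -/

/-- The cell lies in the interior of its triple. This is needed because the kernel represents T only
off the closed support. -/
theorem cell_disjoint_tsupport {q : Triadic n} {f : (Fin n → ℝ) → ℝ}
    (hf : ∀ x ∈ (triple q).toSet, f x = 0) {x : Fin n → ℝ} (hx : x ∈ cell q) : x ∉ tsupport f := by
  have hs := (closedCell q).side_pos
  set W := Metric.ball (closedCell q).center (3 * (closedCell q).side / 2) with hW
  have hxW : x ∈ W := by
    have h1 := cell_subset_closedCell q hx
    rw [Cube.toSet_eq_closedBall, Metric.mem_closedBall] at h1
    rw [hW, Metric.mem_ball]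
    linarith
  have hsub : tsupport f ⊆ Wᶜ := by
    refine closure_minimal (fun y hy hyW => hy (hf y ?_)) Metric.isOpen_ball.isClosed_compl
    rw [Cube.toSet_eq_closedBall]
    exact Metric.ball_subset_closedBall hyW
  exact fun h => hsub h hxW

/-- Take the maximal cells where Ω has density above 1/(2·3^n). Summing the lower bound gives total
volume at most 2·3^n|Ω| ≤ |q|/2, and the failure of the parent gives density at most 1/2. The
threshold is below 1, so Lebesgue density gives the covering. -/
theorem exists_maximal_density_cells {q : Triadic n} {Ω : Set (Fin n → ℝ)} (hΩ : MeasurableSet Ω)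
    (hΩq : 4 * 3 ^ n * volume Ω ≤ volume (cell q)) :
    ∃ G : Set (Triadic n), (∀ p ∈ G, p.1 < q.1 ∧ cell p ⊆ cell q) ∧ G.PairwiseDisjoint cell ∧
      2 * ∑' p : G, volume (cell p.1) ≤ volume (cell q) ∧
      (∀ p ∈ G, 2 * volume (cell p ∩ Ω) ≤ volume (cell p)) ∧
      ∀ᵐ x, x ∈ cell q → x ∈ Ω → ∃ p ∈ G, x ∈ cell p := by
  have h30 : (2 * 3 ^ n : ℝ≥0∞) ≠ 0 := by simp
  have h3t : (2 * 3 ^ n : ℝ≥0∞) ≠ ∞ := by finiteness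
  set P : Set (Triadic n) := {p | p.1 ≤ q.1 ∧ cell p ⊆ cell q ∧
    volume (cell p) < 2 * 3 ^ n * volume (cell p ∩ Ω)} with hP
  set G := maximalCells P with hG
  have hGP : G ⊆ P := maximalCells_subset P
  have hdisj : G.PairwiseDisjoint cell := pairwiseDisjoint_maximalCells P
  have hdisj' : Pairwise (Function.onFun Disjoint fun p : G => cell p.1 ∩ Ω) := fun a b hab =>
    (hdisj a.2 b.2 fun h => hab (Subtype.ext h)).mono inter_subset_left inter_subset_left
  have h22 : (2 : ℝ≥0∞) * 2 = 4 := by norm_num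
  have hlevel : ∀ p ∈ P, p.1 < q.1 := by
    refine fun p hp => lt_of_le_of_ne hp.1 fun h => ?_
    obtain rfl : p = q := eq_of_mem_cell h (center_mem_cell p) (hp.2.1 (center_mem_cell p))
    refine absurd hp.2.2 (not_lt.2 (le_trans ?_ hΩq))
    gcongr
    · norm_num
    · exact inter_subset_right
  refine ⟨G, fun p hp => ⟨hlevel p (hGP hp), (hGP hp).2.1⟩, hdisj, ?_, ?_, ?_⟩
  · calc 2 * ∑' p : G, volume (cell p.1)
        ≤ 2 * ∑' p : G, 2 * 3 ^ n * volume (cell p.1 ∩ Ω) := by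
          gcongr with p
          exact (hGP p.2).2.2.le
      _ = 4 * 3 ^ n * ∑' p : G, volume (cell p.1 ∩ Ω) := by
          rw [ENNReal.tsum_mul_left, ← mul_assoc, ← mul_assoc, h22]
      _ = 4 * 3 ^ n * volume (⋃ p : G, cell p.1 ∩ Ω) := by
          rw [measure_iUnion hdisj' fun p => (measurableSet_cell p.1).inter hΩ]
      _ ≤ 4 * 3 ^ n * volume Ω := by
          gcongr
          exact iUnion_subset fun p => inter_subset_right
      _ ≤ _ := hΩq
  · intro p hp
    have h1 : parent p ∉ P := parent_notMem_of_mem_maximalCells hp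
    have hple : (parent p).1 ≤ q.1 := by
      have := hlevel p (hGP hp)
      simp only [parent]; lia
    have hpq : cell (parent p) ⊆ cell q :=
      cell_subset_cell hple (cell_subset_parent p (center_mem_cell p))
        ((hGP hp).2.1 (center_mem_cell p))
    have h2 : 2 * 3 ^ n * volume (cell (parent p) ∩ Ω) ≤ volume (cell (parent p)) :=
      not_lt.1 fun h => h1 ⟨hple, hpq, h⟩
    rw [volume_parent] at h2
    have h0 : (3 : ℝ≥0∞) ^ n ≠ 0 := by simp
    refine (ENNReal.mul_le_mul_iff_right h0 (by finiteness)).1 (le_trans ?_ h2)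
    calc (3 : ℝ≥0∞) ^ n * (2 * volume (cell p ∩ Ω)) = 2 * 3 ^ n * volume (cell p ∩ Ω) := by ring
      _ ≤ _ := by gcongr; exact cell_subset_parent p
  · have hθ : (2 * 3 ^ n : ℝ≥0∞)⁻¹ < 1 := by
      rw [ENNReal.inv_lt_one]
      calc (1 : ℝ≥0∞) < 2 := by norm_num
        _ ≤ 2 * 3 ^ n := le_mul_of_one_le_right zero_le (one_le_pow₀ (by norm_num))
    filter_upwards [ae_exists_density Ω hΩ q.1 hθ] with x hx hxq hxΩ
    obtain ⟨p, hpq, hxp, hp⟩ := hx hxΩ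
    have hpP : p ∈ P := by
      refine ⟨hpq, cell_subset_cell hpq hxp hxq, ?_⟩
      rw [mul_comm, ← div_eq_mul_inv, ENNReal.div_lt_iff (Or.inl h30) (Or.inl h3t)] at hp
      rwa [mul_comm]
    obtain ⟨p', hp', hpp', -⟩ := exists_mem_maximalCells (P := P) (fun q hq => hq.1) hpP
    exact ⟨p', hp', hpp' hxp⟩

/-- The properties of the children of a cell in the sparse domination of `T f`. -/
structure IsChildren (T : ((Fin n → ℝ) → ℝ) → ((Fin n → ℝ) → ℝ)) (p : ℝ) (C : ℝ≥0)
    (f : (Fin n → ℝ) → ℝ) (q : Triadic n) (G : Set (Triadic n)) : Prop where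
  level_lt : ∀ q' ∈ G, q'.1 < q.1
  subset : ∀ q' ∈ G, cell q' ⊆ cell q
  disjoint : G.PairwiseDisjoint cell
  volume_le : 2 * ∑' q' : G, volume (cell q'.1) ≤ volume (cell q)
  ae_le : ∀ᵐ x, x ∈ cell q → (∀ q' ∈ G, x ∉ cell q') →
    ‖T ((triple q).toSet.indicator f) x‖ₑ ≤ C * cubeAvg p f (triple q)
  ae_le_add : ∀ᵐ x, ∀ q' ∈ G, x ∈ cell q' → ‖T ((triple q).toSet.indicator f) x‖ₑ ≤
    C * cubeAvg p f (triple q) + ‖T ((triple q').toSet.indicator f) x‖ₑ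

/-- In the constant, H·B is the oscillation of T(F_q - F_{q'}) over the child, and B + B·B bounds
its value at the good point as a difference of T F_q and T F_{q'}. -/
theorem exists_isChildren {K : (Fin n → ℝ) → (Fin n → ℝ) → ℝ}
    (hK_meas : AEStronglyMeasurable (Function.uncurry K)
      ((volume : Measure (Fin n → ℝ)).prod (volume : Measure (Fin n → ℝ))))
    {T : ((Fin n → ℝ) → ℝ) → ((Fin n → ℝ) → ℝ)} (hT : IsIntegralOperator T K)
    {r : ℝ≥0∞} (hr : 1 < r) {H B : ℝ≥0} (hH : HormanderBound r K H)
    (hB : HasExceptionalSets T r.conjExponent.toReal B) {f : (Fin n → ℝ) → ℝ} (hf : MemLinftyC f)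
    (q : Triadic n) :
    ∃ G, IsChildren T r.conjExponent.toReal (H * B + B + B * B) f q G := by
  set p := r.conjExponent.toReal with hp
  have hp1 : 1 ≤ p := one_le_toReal_conjExponent hr
  have hp0 : 0 < p := zero_lt_one.trans_le hp1
  choose Ω hΩm hΩv hΩT hΩM using hB f hf
  obtain ⟨G, hG, hdisj, hvol, hhalf, hcov⟩ := exists_maximal_density_cells (hΩm q) (hΩv q)
  refine ⟨G, fun q' h => (hG q' h).1, fun q' h => (hG q' h).2, hdisj, hvol, ?_, ?_⟩
  · filter_upwards [hcov, hΩT q] with x hx1 hx2 hxq hxG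
    refine (hx2 hxq fun hxΩ => ?_).trans ?_
    · obtain ⟨q', hq', hxq'⟩ := hx1 hxq hxΩ
      exact hxG q' hq' hxq'
    · gcongr
      calc B ≤ H * B + B := le_add_self
        _ ≤ _ := le_self_add
  · rw [ae_ball_iff G.to_countable]
    intro q' hq'
    obtain ⟨hlt, hsub⟩ := hG q' hq'
    have htr : (triple q').toSet ⊆ (triple q).toSet := triple_subset_triple hsub hlt.le
    set F := (triple q).toSet.indicator f with hF
    set F' := (triple q').toSet.indicator f with hF'
    set Ψ := (triple q').toSetᶜ.indicator F with hΨ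
    have hFL : MemLinftyC F := hf.indicator (triple q).measurableSet_toSet
    have hFL' : MemLinftyC F' := hf.indicator (triple q').measurableSet_toSet
    have hΨL : MemLinftyC Ψ := hFL.indicator (triple q').measurableSet_toSet.compl
    have hFF' : ∀ x ∈ (triple q').toSet, F x = f x := fun x hx => indicator_of_mem (htr hx) f
    have hFsum : F = F' + Ψ := by
      funext x
      by_cases hx : x ∈ (triple q').toSet
      · simp [hF', hΨ, hx, hFF']
      · simp [hF', hΨ, hx]
    have hΨ0 : ∀ x ∈ (triple q').toSet, Ψ x = 0 := fun x hx =>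
      indicator_of_notMem (notMem_compl_iff.2 hx) F
    have hKm : ∀ᵐ x, AEStronglyMeasurable (K x) volume :=
      AEStronglyMeasurable.prodMk_left hK_meas
    -- Ω q takes at most half of the child and Ω q' at most a quarter. Positive measure, not just
    -- nonemptiness, lets x' also avoid the null sets of the a.e. identities.
    have hgood : volume (cell q' \ (Ω q ∪ Ω q')) ≠ 0 := by
      intro h0
      set V := volume (cell q') with hV
      have h1 : V ≤ volume (cell q' ∩ Ω q) + volume (Ω q') := by
        calc V ≤ volume (cell q' ∩ (Ω q ∪ Ω q')) + volume (cell q' \ (Ω q ∪ Ω q')) :=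
              measure_le_inter_add_sdiff _ _ _
          _ = volume (cell q' ∩ (Ω q ∪ Ω q')) := by rw [h0, add_zero]
          _ ≤ volume ((cell q' ∩ Ω q) ∪ Ω q') := by
              refine measure_mono fun x hx => ?_
              rcases hx.2 with h | h
              · exact Or.inl ⟨hx.1, h⟩
              · exact Or.inr h
          _ ≤ _ := measure_union_le _ _
      have h2 : 4 * volume (Ω q') ≤ V := by
        refine le_trans ?_ (hΩv q')
        gcongr
        exact le_mul_of_one_le_right zero_le (one_le_pow₀ (by norm_num))
      have h3 : 4 * V ≤ 3 * V := by
        calc 4 * V ≤ 4 * (volume (cell q' ∩ Ω q) + volume (Ω q')) := by gcongr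
          _ = 2 * (2 * volume (cell q' ∩ Ω q)) + 4 * volume (Ω q') := by ring
          _ ≤ 2 * V + V := by gcongr; exact hhalf q' hq'
          _ = 3 * V := by ring
      have h4 := (ENNReal.mul_le_mul_iff_left (volume_cell_ne_zero q') (volume_cell_ne_top q')).1 h3
      norm_num at h4
    obtain ⟨x', ⟨hx'q', hx'Ω⟩, hx'1, hx'2, hx'3, hx'4, hx'5⟩ :=
      ((frequently_ae_mem_iff.2 hgood).and_eventually
        ((hΩT q).and ((hΩT q').and ((hT.map_add F' Ψ hFL' hΨL).and
          ((hT.repr Ψ hΨL).and hKm))))).exists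
    rw [mem_union, not_or] at hx'Ω
    set A := cubeAvg p f (triple q) with hA
    have hTF : ‖T F x'‖ₑ ≤ B * A := hx'1 (hsub hx'q') hx'Ω.1
    -- The maximal bound at x', applied to the cube 3q' containing it.
    have hAvg : cubeAvg p f (triple q') ≤ B * A := by
      rw [← ENNReal.rpow_le_rpow_iff hp0]
      refine (ENNReal.mul_le_mul_iff_left (triple q').volume_toSet_ne_zero
        (triple q').volume_toSet_ne_top).1 ?_
      rw [cubeAvg_rpow_mul hp0]
      refine le_of_eq_of_le ?_ (hΩM q x' (hsub hx'q') hx'Ω.1 (triple q')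
        (cell_subset_triple q' hx'q'))
      refine setLIntegral_congr_fun (triple q').measurableSet_toSet fun y hy => ?_
      simp only [← hF, hFF' y hy]
    have hTF' : ‖T F' x'‖ₑ ≤ B * (B * A) := (hx'2 hx'q' hx'Ω.2).trans (by gcongr)
    have hTΨ : ‖T Ψ x'‖ₑ ≤ B * A + B * (B * A) := by
      have h1 : T Ψ x' = T F x' - T F' x' := by
        rw [hFsum, hx'3, Pi.add_apply]; ring
      rw [h1]
      exact enorm_sub_le.trans (add_le_add hTF hTF')
    filter_upwards [hT.map_add F' Ψ hFL' hΨL, hT.repr Ψ hΨL, hKm] with x hx3 hx4 hx5 hxq'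
    obtain ⟨hi, he⟩ := hx4 (cell_disjoint_tsupport hΨ0 hxq')
    obtain ⟨hi', he'⟩ := hx'4 (cell_disjoint_tsupport hΨ0 hx'q')
    have hosc : ‖T Ψ x - T Ψ x'‖ₑ ≤ H * (B * A) := by
      rw [he, he', ← integral_sub hi hi']
      refine (enorm_integral_le_lintegral_enorm _).trans (le_of_eq_of_le ?_
        (lintegral_kernel_sub_mul_le hr hH hxq' hx'q' hx5 hx'5 hFL.1.1
          (hΩM q x' (hsub hx'q') hx'Ω.1)))
      rw [← lintegral_indicator (triple q').measurableSet_toSet.compl]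
      congr 1
      funext y
      by_cases hy : y ∈ (triple q').toSet
      · simp [hy, hΨ0]
      · simp [hy, hΨ, sub_mul]
    calc ‖T F x‖ₑ = ‖(T Ψ x - T Ψ x') + T Ψ x' + T F' x‖ₑ := by
          rw [hFsum, hx3, Pi.add_apply]; congr 1; ring
      _ ≤ ‖T Ψ x - T Ψ x'‖ₑ + ‖T Ψ x'‖ₑ + ‖T F' x‖ₑ :=
          (enorm_add_le _ _).trans (add_le_add_left (enorm_add_le _ _) _)
      _ ≤ H * (B * A) + (B * A + B * (B * A)) + ‖T F' x‖ₑ := by gcongr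
      _ = _ := by push_cast; ring

/-! ### Iteration -/

/-- The descendants of a cell, for a given choice of children. -/
def descendants (ch : Triadic n → Set (Triadic n)) (q : Triadic n) : Set (Triadic n) :=
  {q' | Relation.ReflTransGen (fun a b => b ∈ ch a) q q'}

/-- The descendants of a cell in the `m`-th generation. -/
def generation (ch : Triadic n → Set (Triadic n)) : ℕ → Triadic n → Set (Triadic n)
  | 0, q => {q}
  | m + 1, q => ⋃ q' ∈ ch q, generation ch m q'

theorem volume_generation {ch : Triadic n → Set (Triadic n)}
    (hch : ∀ q, 2 * ∑' q' : ch q, volume (cell q'.1) ≤ volume (cell q)) (m : ℕ) (q : Triadic n) :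
    2 ^ m * ∑' q' : generation ch m q, volume (cell q'.1) ≤ volume (cell q) := by
  induction m generalizing q with
  | zero => simp [generation]
  | succ m ih =>
    calc 2 ^ (m + 1) * ∑' q' : generation ch (m + 1) q, volume (cell q'.1)
        ≤ 2 ^ (m + 1) * ∑' (q₁ : ch q) (q' : generation ch m q₁.1), volume (cell q'.1) := by
          gcongr
          exact ENNReal.tsum_biUnion_le_tsum (fun q' => volume (cell q')) (ch q) (generation ch m)
      _ = 2 * ∑' q₁ : ch q, 2 ^ m * ∑' q' : generation ch m q₁.1, volume (cell q'.1) := by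
          rw [ENNReal.tsum_mul_left]; ring
      _ ≤ 2 * ∑' q₁ : ch q, volume (cell q₁.1) := by
          gcongr with q₁
          exact ih q₁.1
      _ ≤ _ := hch q

/-- The points that stay in the tree forever form a set of measure at most 2^{-m}|q| for every m. -/
theorem ae_exists_notMem_generation {ch : Triadic n → Set (Triadic n)}
    (hch : ∀ q, 2 * ∑' q' : ch q, volume (cell q'.1) ≤ volume (cell q)) (q : Triadic n) :
    ∀ᵐ x, ∃ m, ∀ q' ∈ generation ch m q, x ∉ cell q' := by
  have hnull : volume (⋂ m, ⋃ q' : generation ch m q, cell q'.1) = 0 := by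
    set v := volume (⋂ m, ⋃ q' : generation ch m q, cell q'.1) with hv
    have h1 : ∀ m : ℕ, 2 ^ m * v ≤ volume (cell q) := fun m => by
      refine le_trans ?_ (volume_generation hch m q)
      gcongr
      exact (measure_mono (iInter_subset _ m)).trans (measure_iUnion_le _)
    by_contra h0
    have hvt : v ≠ ∞ := by
      have := h1 0
      rw [pow_zero, one_mul] at this
      exact ne_top_of_le_ne_top (volume_cell_ne_top q) this
    obtain ⟨m, hm⟩ := ENNReal.exists_nat_mul_gt h0 (volume_cell_ne_top q)
    refine absurd (h1 m) (not_le.2 (hm.trans_le ?_))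
    gcongr
    exact_mod_cast Nat.lt_two_pow_self.le
  filter_upwards [compl_mem_ae_iff.2 hnull] with x hx
  simpa using hx

theorem descendants_level_le {ch : Triadic n → Set (Triadic n)}
    (hch : ∀ q, ∀ q' ∈ ch q, q'.1 < q.1) {q q' : Triadic n} (h : q' ∈ descendants ch q) :
    q'.1 ≤ q.1 := by
  induction h with
  | refl => exact le_rfl
  | tail _ h ih => exact (hch _ _ h).le.trans ih

theorem descendants_subset {ch : Triadic n → Set (Triadic n)}
    (hch : ∀ q, ∀ q' ∈ ch q, cell q' ⊆ cell q) {q q' : Triadic n} (h : q' ∈ descendants ch q) :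
    cell q' ⊆ cell q := by
  induction h with
  | refl => exact Subset.rfl
  | tail _ h ih => exact (hch _ _ h).trans ih

/-- Two descendants of the same cell that share a point are comparable. -/
theorem descendants_comparable {ch : Triadic n → Set (Triadic n)}
    (hsub : ∀ q, ∀ q' ∈ ch q, cell q' ⊆ cell q) (hdisj : ∀ q, (ch q).PairwiseDisjoint cell)
    {q q₁ q₂ : Triadic n} (h₁ : q₁ ∈ descendants ch q) (h₂ : q₂ ∈ descendants ch q)
    {x : Fin n → ℝ} (hx₁ : x ∈ cell q₁) (hx₂ : x ∈ cell q₂) :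
    q₁ ∈ descendants ch q₂ ∨ q₂ ∈ descendants ch q₁ := by
  change Relation.ReflTransGen (fun a b => b ∈ ch a) q q₁ at h₁
  induction h₁ using Relation.ReflTransGen.head_induction_on with
  | refl => exact Or.inr h₂
  | @head a c hac hc ih =>
    rcases Relation.ReflTransGen.cases_head h₂ with rfl | ⟨c', hac', hc'⟩
    · exact Or.inl (Relation.ReflTransGen.head hac hc)
    · have : c = c' := (hdisj a).elim_set hac hac' x (descendants_subset hsub hc hx₁)
        (descendants_subset hsub hc' hx₂)
      subst this
      exact ih hc'

/-- The recursion is followed along the branch of cells containing the fixed point x, which ends in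
fewer than m steps. Each step pays one term, and no term is paid twice because generations strictly
decrease. -/
theorem enorm_le_tsum_descendants {T : ((Fin n → ℝ) → ℝ) → ((Fin n → ℝ) → ℝ)} {p : ℝ} {C : ℝ≥0}
    {f : (Fin n → ℝ) → ℝ} {ch : Triadic n → Set (Triadic n)}
    (hlt : ∀ q, ∀ q' ∈ ch q, q'.1 < q.1) {x : Fin n → ℝ}
    (hx : ∀ q, x ∈ cell q → (∀ q' ∈ ch q, x ∉ cell q') →
      ‖T ((triple q).toSet.indicator f) x‖ₑ ≤ C * cubeAvg p f (triple q))
    (hx' : ∀ q, ∀ q' ∈ ch q, x ∈ cell q' → ‖T ((triple q).toSet.indicator f) x‖ₑ ≤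
      C * cubeAvg p f (triple q) + ‖T ((triple q').toSet.indicator f) x‖ₑ)
    (m : ℕ) (q : Triadic n) (hxq : x ∈ cell q) (hm : ∀ q' ∈ generation ch m q, x ∉ cell q') :
    ‖T ((triple q).toSet.indicator f) x‖ₑ ≤
      C * ∑' q' : descendants ch q,
        (triple q'.1).toSet.indicator (fun _ => cubeAvg p f (triple q'.1)) x := by
  induction m generalizing q with
  | zero => exact absurd hxq (hm q rfl)
  | succ m ih =>
    set φ : Triadic n → ℝ≥0∞ := fun q' =>
      (triple q').toSet.indicator (fun _ => cubeAvg p f (triple q')) x with hφ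
    have hφq : φ q = cubeAvg p f (triple q) :=
      indicator_of_mem (cell_subset_triple q hxq) _
    by_cases hex : ∃ q' ∈ ch q, x ∈ cell q'
    · obtain ⟨q', hq', hxq'⟩ := hex
      have h1 := ih q' hxq' fun q'' hq'' => hm q'' (mem_biUnion hq' hq'')
      have hd : Disjoint ({q} : Set (Triadic n)) (descendants ch q') := by
        rw [Set.disjoint_singleton_left]
        exact fun h => absurd (descendants_level_le hlt h) (not_le.2 (hlt q q' hq'))
      have hs : {q} ∪ descendants ch q' ⊆ descendants ch q := by
        rintro z (rfl | hz)
        · exact Relation.ReflTransGen.refl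
        · exact Relation.ReflTransGen.head hq' hz
      calc ‖T ((triple q).toSet.indicator f) x‖ₑ
          ≤ C * φ q + C * ∑' z : descendants ch q', φ z := by
            rw [hφq]
            exact (hx' q q' hq' hxq').trans (add_le_add_right h1 _)
        _ = C * ∑' z : ({q} ∪ descendants ch q' : Set (Triadic n)), φ z := by
            rw [ENNReal.summable.tsum_union_disjoint hd ENNReal.summable, tsum_singleton, mul_add]
        _ ≤ C * ∑' z : descendants ch q, φ z := by
            gcongr
            exact ENNReal.tsum_mono_subtype φ hs
    · push Not at hex
      refine (hx q hxq hex).trans ?_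
      gcongr
      rw [← hφq]
      exact ENNReal.le_tsum (f := fun z : descendants ch q => φ z) ⟨q, Relation.ReflTransGen.refl⟩

/-! ### Sparseness of the selected family. -/

/-- The part of a cell that is not covered by its children. -/
def remainder (ch : Triadic n → Set (Triadic n)) (q : Triadic n) : Set (Fin n → ℝ) :=
  cell q \ ⋃ q' : ch q, cell q'.1

theorem volume_cell_le_remainder {ch : Triadic n → Set (Triadic n)}
    (hch : ∀ q, 2 * ∑' q' : ch q, volume (cell q'.1) ≤ volume (cell q)) (q : Triadic n) :
    volume (cell q) ≤ 2 * volume (remainder ch q) := by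
  set V := volume (cell q) with hV
  have h1 : V ≤ volume (⋃ q' : ch q, cell q'.1) + volume (remainder ch q) := by
    refine (measure_le_inter_add_sdiff _ _ (⋃ q' : ch q, cell q'.1)).trans ?_
    gcongr
    · exact inter_subset_right
    · exact Subset.rfl
  have h2 : 2 * volume (⋃ q' : ch q, cell q'.1) ≤ V :=
    le_trans (by gcongr; exact measure_iUnion_le _) (hch q)
  have h3 : V + V ≤ V + 2 * volume (remainder ch q) := by
    calc V + V = 2 * V := (two_mul V).symm
      _ ≤ 2 * (volume (⋃ q' : ch q, cell q'.1) + volume (remainder ch q)) := by gcongr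
      _ = 2 * volume (⋃ q' : ch q, cell q'.1) + 2 * volume (remainder ch q) := mul_add _ _ _
      _ ≤ _ := by gcongr
  exact (ENNReal.add_le_add_iff_left (volume_cell_ne_top q)).1 h3

/-- Two selected cells sharing a point have the same top cell and are comparable; a proper
descendant lies in a child of the larger cell, which the remainder of that cell excludes. -/
theorem pairwiseDisjoint_remainder {ch : Triadic n → Set (Triadic n)}
    (hsub : ∀ q, ∀ q' ∈ ch q, cell q' ⊆ cell q) (hdisj : ∀ q, (ch q).PairwiseDisjoint cell)
    {top : Set (Triadic n)} (htop : top.PairwiseDisjoint cell) :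
    (⋃ q ∈ top, descendants ch q).PairwiseDisjoint (remainder ch) := by
  have key : ∀ {q₁ q₂ : Triadic n} {x : Fin n → ℝ}, q₁ ∈ descendants ch q₂ → x ∈ cell q₁ →
      x ∈ remainder ch q₂ → q₂ = q₁ := by
    intro q₁ q₂ x h hx₁ hx₂
    rcases Relation.ReflTransGen.cases_head h with rfl | ⟨c, hc, hc'⟩
    · rfl
    · exact absurd (mem_iUnion.2 ⟨⟨c, hc⟩, descendants_subset hsub hc' hx₁⟩) hx₂.2
  intro q₁ h₁ q₂ h₂ hne
  refine Set.disjoint_left.2 fun x hx₁ hx₂ => hne ?_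
  obtain ⟨t₁, ht₁, h₁⟩ := mem_iUnion₂.1 h₁
  obtain ⟨t₂, ht₂, h₂⟩ := mem_iUnion₂.1 h₂
  obtain rfl : t₁ = t₂ := htop.elim_set ht₁ ht₂ x (descendants_subset hsub h₁ hx₁.1)
    (descendants_subset hsub h₂ hx₂.1)
  rcases descendants_comparable hsub hdisj h₁ h₂ hx₁.1 hx₂.1 with h | h
  · exact (key h hx₁.1 hx₂).symm
  · exact key h hx₂.1 hx₁

/-- Used to pass from families of labels to families of cubes, both for the disjoint sets and for
the sum. -/
theorem triple_injective : Function.Injective (triple : Triadic n → Cube n) := by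
  rintro ⟨k, v⟩ ⟨l, w⟩ h
  simp only [triple, closedCell, Cube.dilate, Cube.mk.injEq] at h
  obtain ⟨h1, h2⟩ := h
  have h3 : (3 : ℝ) ^ k = 3 ^ l := by linarith
  obtain rfl : k = l := zpow_right_injective₀ (by norm_num) (by norm_num) h3
  have h4 : (3 : ℝ) ^ k ≠ 0 := by positivity
  obtain rfl : v = w := by
    funext i
    have := congrFun h1 i
    exact_mod_cast mul_left_cancel₀ h4 this
  rfl

theorem isSparse_triple_image {S : Set (Triadic n)} {E : Triadic n → Set (Fin n → ℝ)}
    (hE : ∀ q ∈ S, MeasurableSet (E q) ∧ E q ⊆ cell q ∧ volume (cell q) ≤ 2 * volume (E q))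
    (hd : S.PairwiseDisjoint E) : IsSparse (1 / (2 * 3 ^ n)) (triple '' S) := by
  refine ⟨Function.extend triple E fun _ => ∅, ?_, ?_⟩
  · rintro _ ⟨q, hq, rfl⟩
    rw [triple_injective.extend_apply]
    obtain ⟨h1, h2, h3⟩ := hE q hq
    refine ⟨h1, h2.trans (cell_subset_triple q), ?_⟩
    have h30 : (2 * 3 ^ n : ℝ≥0∞) ≠ 0 := by simp
    have h3t : (2 * 3 ^ n : ℝ≥0∞) ≠ ∞ := by finiteness
    rw [volume_triple, one_div, ENNReal.inv_mul_le_iff h30 h3t, mul_comm 2, mul_assoc]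
    gcongr
  · rintro _ ⟨q, hq, rfl⟩ _ ⟨q', hq', rfl⟩ hne
    rw [Function.onFun, triple_injective.extend_apply, triple_injective.extend_apply]
    exact hd hq hq' fun h => hne (by rw [h])

/-! ### The top cells -/

/-- A partition of the space into cells whose triples all contain the cell of generation `N` at the
origin. -/
def topCells (n : ℕ) (N : ℤ) : Set (Triadic n) :=
  {q | N ≤ q.1 ∧ (∀ i, |q.2 i| ≤ 1) ∧ (q.1 = N ∨ q.2 ≠ 0)}

theorem idx_zero (k : ℤ) : idx k (0 : Fin n → ℝ) = 0 := by
  funext i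
  simp only [idx, Pi.zero_apply, zero_div, zero_add]
  norm_num

/-- The children of a central cell are the central cell one generation below and its neighbours. -/
theorem idx_succ_eq_zero_iff {k : ℤ} {x : Fin n → ℝ} :
    idx (k + 1) x = 0 ↔ ∀ i, |idx k x i| ≤ 1 := by
  rw [idx_succ, funext_iff]
  refine forall_congr' fun i => ?_
  rw [abs_le, Pi.zero_apply]
  constructor
  · intro h; lia
  · intro h; lia

/-- The parent of a top cell is central, so at every later generation its points have index 0, which
is excluded for top cells above generation N. -/
theorem pairwiseDisjoint_topCells (N : ℤ) : (topCells n N).PairwiseDisjoint cell := by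
  have key : ∀ {q q' : Triadic n} {x : Fin n → ℝ}, q ∈ topCells n N → q' ∈ topCells n N →
      x ∈ cell q → x ∈ cell q' → ¬ q.1 < q'.1 := by
    intro q q' x hq hq' hx hx' hlt
    have h1 : idx q.1 x = q.2 := hx
    have h2 : idx (q.1 + 1) x = idx (q.1 + 1) 0 := by
      rw [idx_zero, idx_succ_eq_zero_iff, h1]; exact hq.2.1
    have h3 := idx_eq_of_le (show q.1 + 1 ≤ q'.1 from hlt) h2
    rw [idx_zero, show idx q'.1 x = q'.2 from hx'] at h3
    rcases hq'.2.2 with h | h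
    · exact absurd (hq.1.trans_lt hlt) (by rw [h]; exact lt_irrefl _)
    · exact h h3
  intro q hq q' hq' hne
  refine Set.disjoint_left.2 fun x hx hx' => hne ?_
  exact eq_of_mem_cell (le_antisymm (not_lt.1 (key hq' hq hx' hx)) (not_lt.1 (key hq hq' hx hx')))
    hx hx'

/-- Take the first generation from N on at which the index of x has entries of size at most 1. After
generation N this index is nonzero, since otherwise the preceding generation would already qualify.
-/
theorem exists_mem_topCells (N : ℤ) (x : Fin n → ℝ) : ∃ q ∈ topCells n N, x ∈ cell q := by
  have hex : ∃ m : ℕ, ∀ i, |idx (N + m) x i| ≤ 1 := by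
    obtain ⟨m, hm⟩ := pow_unbounded_of_one_lt (‖x‖ / 3 ^ N) (show (1 : ℝ) < 3 by norm_num)
    refine ⟨m, fun i => ?_⟩
    have h3 : (0 : ℝ) < 3 ^ N := by positivity
    have := idx_sub_le_one (k := N + m) (x := x) (y := 0) (fun i => ?_) i
    · simpa [idx_zero] using this
    · rw [div_lt_iff₀ h3] at hm
      rw [Pi.zero_apply, sub_zero, zpow_add₀ (by norm_num), zpow_natCast, mul_comm]
      exact (norm_le_pi_norm x i).trans hm.le
  classical
  refine ⟨(N + Nat.find hex, idx (N + Nat.find hex) x), ⟨by simp, Nat.find_spec hex, ?_⟩,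
    mem_cell_idx _ x⟩
  rcases Nat.eq_zero_or_pos (Nat.find hex) with h | h
  · left; simp only [h]; simp
  · right
    intro h0
    refine Nat.find_min hex (Nat.sub_one_lt h.ne') (idx_succ_eq_zero_iff.1 ?_)
    rw [show N + ((Nat.find hex - 1 : ℕ) : ℤ) + 1 = N + (Nat.find hex : ℕ) by lia]
    exact h0

/-- A top cell is the central cell of its generation or a neighbour of it, so its triple contains
that central cell and all smaller ones. -/
theorem closedCell_zero_subset_triple {N : ℤ} {q : Triadic n} (hq : q ∈ topCells n N) :
    (closedCell ((N, 0) : Triadic n)).toSet ⊆ (triple q).toSet := by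
  intro x hx i
  have h1 := hx i
  have h2 : (3 : ℝ) ^ N ≤ 3 ^ q.1 := zpow_le_zpow_right₀ (by norm_num) hq.1
  have h3 : |(q.2 i : ℝ)| ≤ 1 := by exact_mod_cast hq.2.1 i
  have h4 : (0 : ℝ) < 3 ^ q.1 := by positivity
  simp only [closedCell, triple, Cube.dilate, Pi.zero_apply, Int.cast_zero, mul_zero,
    sub_zero] at *
  rw [abs_le] at *
  constructor <;> nlinarith

theorem MemLinftyC.exists_closedCell {f : (Fin n → ℝ) → ℝ} (hf : MemLinftyC f) :
    ∃ N : ℤ, ∀ x ∉ (closedCell ((N, 0) : Triadic n)).toSet, f x = 0 := by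
  obtain ⟨ρ, hρ⟩ := hf.2.isCompact.isBounded.subset_closedBall 0
  obtain ⟨m, hm⟩ := pow_unbounded_of_one_lt (2 * ρ) (show (1 : ℝ) < 3 by norm_num)
  refine ⟨m, fun x hx => ?_⟩
  by_contra h0
  refine hx ?_
  have h1 := hρ (subset_tsupport f h0)
  rw [mem_closedBall_zero_iff] at h1
  intro i
  have h2 := norm_le_pi_norm x i
  rw [Real.norm_eq_abs] at h2
  simp only [closedCell, Pi.zero_apply, Int.cast_zero, mul_zero, sub_zero, zpow_natCast]
  linarith

end SparseT1

theorem theorem4p1 (n : ℕ) (hn : 0 < n)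
    (K : (Fin n → ℝ) → (Fin n → ℝ) → ℝ)
    (hK_meas : AEStronglyMeasurable (Function.uncurry K)
      ((volume : Measure (Fin n → ℝ)).prod (volume : Measure (Fin n → ℝ))))
    (T T' : ((Fin n → ℝ) → ℝ) → ((Fin n → ℝ) → ℝ))
    (hT : SparseT1.IsIntegralOperator T K)
    (hT' : SparseT1.IsTranspose T T')
    (r : ℝ≥0∞) (hr : 1 < r)
    (hK : SparseT1.Hormander r K)
    (hK' : SparseT1.Hormander 1 (fun x y => K y x))
    (hcube : ∃ C : ℝ≥0, ∀ (Q : SparseT1.Cube n) (E : Set (Fin n → ℝ)), MeasurableSet E →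
      E ⊆ Q.toSet →
        ∫⁻ x in Q.toSet, ‖T' (E.indicator fun _ => (1 : ℝ)) x‖ₑ ≤ C * volume Q.toSet) :
    ∃ C : ℝ≥0, ∀ f : (Fin n → ℝ) → ℝ, SparseT1.MemLinftyC f →
      ∃ S : Set (SparseT1.Cube n), SparseT1.IsSparse (1 / (2 * 3 ^ n)) S ∧
        ∀ᵐ x, ‖T f x‖ₑ ≤ C * SparseT1.sparseSum r.conjExponent.toReal S f x := by
  obtain ⟨H, hH⟩ := hK.exists_bound
  obtain ⟨H', hH'⟩ := hK'.exists_bound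
  obtain ⟨C₀, hC₀⟩ := hcube
  obtain ⟨B, hB⟩ := SparseT1.exists_hasExceptionalSets hK_meas hT hT' hH' hC₀
    (SparseT1.one_le_toReal_conjExponent hr)
  refine ⟨H * B + B + B * B, fun f hf => ?_⟩
  choose ch hch using SparseT1.exists_isChildren hK_meas hT hr hH hB hf
  have hlt := fun q => (hch q).level_lt
  have hsub := fun q => (hch q).subset
  have hdisj := fun q => (hch q).disjoint
  have hvol := fun q => (hch q).volume_le
  obtain ⟨N, hN⟩ := hf.exists_closedCell
  set S₀ := ⋃ q ∈ SparseT1.topCells n N, SparseT1.descendants ch q with hS₀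
  refine ⟨SparseT1.triple '' S₀, SparseT1.isSparse_triple_image (E := SparseT1.remainder ch)
    (fun q _ => ⟨(SparseT1.measurableSet_cell q).diff
      (MeasurableSet.iUnion fun q' => SparseT1.measurableSet_cell q'.1), sdiff_subset,
      SparseT1.volume_cell_le_remainder hvol q⟩)
    (SparseT1.pairwiseDisjoint_remainder hsub hdisj (SparseT1.pairwiseDisjoint_topCells N)), ?_⟩
  filter_upwards [ae_all_iff.2 fun q => (hch q).ae_le, ae_all_iff.2 fun q => (hch q).ae_le_add,
    ae_all_iff.2 fun q => SparseT1.ae_exists_notMem_generation hvol q] with x hx₁ hx₂ hx₃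
  obtain ⟨q, hq, hxq⟩ := SparseT1.exists_mem_topCells N x
  obtain ⟨m, hm⟩ := hx₃ q
  -- On a top cell the localisation to the triple loses nothing, so the recursion starts from T f
  -- itself.
  have hfq : (SparseT1.triple q).toSet.indicator f = f := by
    rw [indicator_eq_self]
    intro y hy
    by_contra h
    exact hy (hN y fun h' => h (SparseT1.closedCell_zero_subset_triple hq h'))
  have hmain := SparseT1.enorm_le_tsum_descendants hlt hx₁ hx₂ m q hxq hm
  rw [hfq] at hmain
  refine hmain.trans ?_
  gcongr
  rw [SparseT1.sparseSum, tsum_image (fun Q : SparseT1.Cube n =>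
    Q.toSet.indicator (fun _ => SparseT1.cubeAvg r.conjExponent.toReal f Q) x)
    SparseT1.triple_injective.injOn]
  exact ENNReal.tsum_mono_subtype (fun q' : SparseT1.Triadic n =>
    (SparseT1.triple q').toSet.indicator
      (fun _ => SparseT1.cubeAvg r.conjExponent.toReal f (SparseT1.triple q')) x)
    (subset_biUnion_of_mem (u := SparseT1.descendants ch) hq)
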